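/- For a prime $p$, a subgroup $\mathcal{G} \subseteq \mathbb{F}_p^*$ and a real number $H$, let $\mathcal{U}(p;\mathcal{G},H)$ be the set of $u \in \mathbb{F}_p$ such that the congruence $$v \equiv u + x \pmod p, \qquad v \in \mathcal{G}, \quad x \in \mathbb{Z}, \ 0 \le x < H,$$ has no solution. Then for any fixed $\varepsilon > 0$ we have $\#\mathcal{U}(p;\mathcal{G},H) = o(p)$ as $p \to \infty$, uniformly over all subgroups $\mathcal{G} \subseteq \mathbb{F}_p^*$ of order $t > p^{1/2}$ and all real $H \ge p^{19/24+\varepsilon}$. That is, for all $\varepsilon > 0$ and $\delta > 0$ there is $P$ such that, for every prime $p \ge P$, every subgroup $\mathcal{G} \subseteq \mathbb{F}_p^*$ of order $t > p^{1/2}$ and every real $H \ge p^{19/24+\varepsilon}$, we have $\#\mathcal{U}(p;\mathcal{G},H) \le \delta p$. -/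

import Mathlib

/-- `avoidingSet p G H` is the set `𝒰(p; G, H)` of those `u ∈ 𝔽_p` for which the congruence
`v ≡ u + x (mod p)` has no solution with `v ∈ G` and an integer `x` with `0 ≤ x < H`. -/
def avoidingSet (p : ℕ) (G : Subgroup (ZMod p)ˣ) (H : ℝ) : Set (ZMod p) :=
  {u | ¬ ∃ v ∈ G, ∃ x : ℕ, (x : ℝ) < H ∧ (v : ZMod p) = u + (x : ZMod p)}

/-!
Write `t` for the order of `G`, so that `G` is the set of `t`-th roots of unity in `𝔽_p`, and
`S(a) = ∑ v ∈ G, e(a v / p)`. Let `U` be the avoiding set and `k` a fixed large integer, and let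
`K ≈ H / k`. No `u ∈ U` is the difference of an element of `G` and a sum of `k` elements of `[0, K)`,
so by Parseval and Cauchy–Schwarz (`card_avoiding_le`)
`#U t ^ 2 K ^ (2 k) ≤ p ∑ a ≠ 0, |S(a)| ^ 2 |I(a)| ^ (2 k)`, where `I` is the exponential sum of
`[0, K)`. Since `|I(a)| ≤ p / (2 |a|)`, a large `k` makes the frequencies beyond
`Z = p ^ (5 / 24 - ε / 2)` negligible, and it remains to show that `∑ 1 ≤ n ≤ Z, |S(n)| ^ 2` is
`o(t ^ 2)` (`sum_short_pow_six_le`). For `t > p ^ (5 / 8)` the bound `|S(n)| ^ 2 ≤ p` suffices.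
Otherwise `S` is constant on cosets of `G`, and Cauchy–Schwarz over the cosets
(`sq_sum_short_le`) gives the bound `(p E N(Z) / t) ^ (1 / 2)`, with two ingredients.

* `E`, the additive energy of `G`, is `O(t ^ (5 / 2))` (`sum_sq_diffCount_le`). This is the
  theorem of Heath-Brown and Konyagin, by Stepanov's method (`stepanov_bound`): a combination of
  `X ^ (a + t b) (X - 1) ^ (t d)` is made to vanish to a high order at all `x` for which
  `x ^ t = (x - 1) ^ t` takes one of `m` given values; these `x` parametrize the differences of
  elements of `G` that lie in `m` given cosets.
* `N(Z)` counts the pairs `a, b ≤ Z` with `a / b ∈ G`. Distinct fractions of height `W` in one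
  residue class are `p / W ^ 2` apart, so there are at most `2 t (W ^ 2 / p + 1)` reduced fractions
  of height `W` in `G`. Multiplying pairs and the divisor bound give
  `N(Y) N(Z) ≤ p ^ o(1) N(Y Z)`. Using the spacing bound at lengths up to `p ^ (3 / 4)`, then
  `N(W) ^ 2 ≤ p ^ o(1) N(W ^ 2)` for `W ≤ p ^ (3 / 8)`, and then
  `N(Z) ^ 3 ≤ p ^ o(1) N(Z ^ 3)`, one finds
  `N(Z) ^ 3 ≤ p ^ o(1) t Z ^ 3 p ^ (-3 / 8)` for `Z ≤ p ^ (5 / 24)` (`powCount_cube_le`).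

At `t = p ^ (1 / 2)` the two bounds together save a power of `p` exactly when `Z` is smaller than
`p ^ (5 / 24)` by a power of `p`, which is the exponent `19 / 24 = 1 - 5 / 24`.
-/

open Finset

/-! ### The derivation `X (X - 1) d/dX` and sparse polynomials -/

section Stepanov

open Polynomial

/-- The derivation `X (X - 1) d/dX` of `F[X]`. -/
noncomputable def eulerOp (F : Type*) [Field F] : Module.End F F[X] :=
  LinearMap.mulLeft F (X * (X - 1)) ∘ₗ derivative

/-- The conjugate of `eulerOp` by multiplication with `X ^ i * (X - 1) ^ j`. -/
noncomputable def twistedEulerOp (F : Type*) [Field F] (i j : ℕ) : Module.End F F[X] :=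
  eulerOp F + LinearMap.mulLeft F ((i : F[X]) * (X - 1) + (j : F[X]) * X)

variable {F : Type*} [Field F]

lemma eulerOp_apply (P : F[X]) : eulerOp F P = X * (X - 1) * derivative P := rfl

lemma twistedEulerOp_apply (i j : ℕ) (P : F[X]) :
    twistedEulerOp F i j P =
      X * (X - 1) * derivative P + ((i : F[X]) * (X - 1) + (j : F[X]) * X) * P := rfl

lemma eulerOp_mul_pow (i j : ℕ) (q : F[X]) :
    eulerOp F (X ^ i * (X - 1) ^ j * q) = X ^ i * (X - 1) ^ j * twistedEulerOp F i j q := by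
  rw [eulerOp_apply, twistedEulerOp_apply]
  have hX : X * derivative (X ^ i : F[X]) = (i : F[X]) * X ^ i := by
    cases i with
    | zero => simp
    | succ n => simp; ring
  have hX1 : (X - 1) * derivative ((X - 1) ^ j : F[X]) = (j : F[X]) * (X - 1) ^ j := by
    cases j with
    | zero => simp
    | succ n => simp [derivative_pow]; ring
  rw [derivative_mul, derivative_mul]
  linear_combination (X - 1) * (X - 1) ^ j * q * hX + X * X ^ i * q * hX1

lemma eulerOp_pow_mul_pow (n i j : ℕ) (q : F[X]) :
    (eulerOp F ^ n) (X ^ i * (X - 1) ^ j * q) =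
      X ^ i * (X - 1) ^ j * (twistedEulerOp F i j ^ n) q := by
  induction n generalizing q with
  | zero => simp
  | succ n ih => rw [pow_succ, Module.End.mul_apply, eulerOp_mul_pow, ih, pow_succ,
      Module.End.mul_apply]

lemma natDegree_twistedEulerOp_le (i j : ℕ) (q : F[X]) :
    (twistedEulerOp F i j q).natDegree ≤ q.natDegree + 1 := by
  rw [twistedEulerOp_apply]
  have hX1 : (X - 1 : F[X]).natDegree ≤ 1 := by
    simpa using natDegree_X_sub_C_le (1 : F)
  refine natDegree_add_le_of_degree_le ?_ ?_
  · rcases Nat.eq_zero_or_pos q.natDegree with h0 | hpos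
    · rw [derivative_of_natDegree_zero h0]; simp
    · have hd := natDegree_derivative_le q
      have h1 := natDegree_mul_le (p := (X * (X - 1) : F[X])) (q := derivative q)
      have h2 := natDegree_mul_le (p := (X : F[X])) (q := X - 1)
      have h3 := natDegree_X_le (R := F)
      omega
  · refine natDegree_mul_le.trans ?_
    have : ((i : F[X]) * (X - 1) + (j : F[X]) * X).natDegree ≤ 1 := by
      refine natDegree_add_le_of_degree_le ?_ ?_
      · refine natDegree_mul_le.trans ?_
        simpa using hX1
      · refine natDegree_mul_le.trans ?_
        simp
    omega

lemma natDegree_twistedEulerOp_pow_le (n i j : ℕ) (q : F[X]) :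
    ((twistedEulerOp F i j ^ n) q).natDegree ≤ q.natDegree + n := by
  induction n with
  | zero => simp
  | succ n ih =>
    rw [pow_succ', Module.End.mul_apply]
    have := natDegree_twistedEulerOp_le i j ((twistedEulerOp F i j ^ n) q)
    omega

/-- Each application of `eulerOp` lowers the order of vanishing at `x ≠ 0, 1` by exactly one, as
long as that order is not divisible by the characteristic. -/
lemma eval_eulerOp_pow (k : ℕ) (x : F) (R : F[X]) :
    ((eulerOp F ^ k) ((X - C x) ^ k * R)).eval x = (k.factorial : F) * (x * (x - 1)) ^ k * R.eval x
    := by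
  induction k generalizing R with
  | zero => simp
  | succ k ih =>
    have h : eulerOp F ((X - C x) ^ (k + 1) * R) = (X - C x) ^ k *
        (((k + 1 : ℕ) : F[X]) * (X * (X - 1)) * R + (X - C x) * (X * (X - 1)) * derivative R) := by
      rw [eulerOp_apply, derivative_mul, derivative_X_sub_C_pow]
      simp only [Nat.add_sub_cancel, C_eq_natCast]
      ring
    rw [pow_succ, Module.End.mul_apply, h, ih]
    simp only [eval_add, eval_mul, eval_natCast, eval_X, eval_sub, eval_one, eval_C, sub_self,
      zero_mul, add_zero, Nat.factorial_succ, Nat.cast_mul]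
    ring

lemma X_sub_C_pow_dvd_of_eulerOp {p : ℕ} [Fact p.Prime] [CharP F p] {D : ℕ} (hD : D ≤ p) {x : F}
    (hx0 : x ≠ 0) (hx1 : x ≠ 1) {P : F[X]} (hP : ∀ n < D, ((eulerOp F ^ n) P).eval x = 0) :
    (X - C x) ^ D ∣ P := by
  suffices ∀ k ≤ D, (X - C x) ^ k ∣ P from this D le_rfl
  intro k
  induction k with
  | zero => simp
  | succ k ih =>
    intro hk
    obtain ⟨R, rfl⟩ := ih (by omega)
    have h := hP k (by omega)
    rw [eval_eulerOp_pow] at h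
    have hfac : (k.factorial : F) ≠ 0 := by
      rw [Ne, CharP.cast_eq_zero_iff F p, (Fact.out : p.Prime).dvd_factorial]
      omega
    have hR : R.eval x = 0 := by
      simpa [hfac, hx0, sub_ne_zero.2 hx1] using h
    rw [pow_succ]
    exact mul_dvd_mul_left _ (dvd_iff_isRoot.2 hR)

/-- A polynomial of degree less than the characteristic vanishes at `1` to an order less than its
number of monomials. -/
lemma eq_zero_of_sparse {p : ℕ} [CharP F p] (k : ℕ) {f : F[X]}
    (hdeg : f.natDegree < p) (hsupp : #f.support ≤ k) (hdvd : (X - 1) ^ k ∣ f) : f = 0 := by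
  induction k generalizing f with
  | zero => simpa using hsupp
  | succ k ih =>
    by_contra hf
    obtain ⟨j, hj⟩ := (nonempty_support_iff.2 hf)
    -- `X f' - j f` has the monomials of `f` other than `X ^ j`.
    set h : F[X] := X * derivative f - (j : F[X]) * f with hh
    have hcoeff : ∀ i, h.coeff i = ((i : F) - j) * f.coeff i := by
      intro i
      rw [hh, coeff_sub, coeff_natCast_mul]
      cases i with
      | zero => simp
      | succ i => rw [coeff_X_mul, coeff_derivative]; push_cast; ring
    have hsub : h.support ⊆ f.support.erase j := by
      intro i hi
      rw [mem_support_iff, hcoeff] at hi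
      rw [mem_erase, mem_support_iff]
      refine ⟨?_, right_ne_zero_of_mul hi⟩
      rintro rfl
      simp at hi
    have hh0 : h = 0 := by
      apply ih
      · refine lt_of_le_of_lt ?_ hdeg
        rw [natDegree_le_iff_coeff_eq_zero]
        intro i hi
        rw [hcoeff, coeff_eq_zero_of_natDegree_lt hi, mul_zero]
      · have := card_le_card hsub
        rw [card_erase_of_mem hj] at this
        omega
      · obtain ⟨g, rfl⟩ := hdvd
        refine dvd_sub (Dvd.dvd.mul_left ?_ _) (Dvd.dvd.mul_left ?_ _)
        · rw [derivative_mul, derivative_pow]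
          refine dvd_add (Dvd.dvd.mul_right (Dvd.dvd.mul_right ?_ _) _)
            (Dvd.dvd.mul_right (pow_dvd_pow _ (by omega)) _)
          simp
        · exact Dvd.dvd.mul_right (pow_dvd_pow _ (by omega)) _
    have hjlt : j < p := (le_natDegree_of_mem_supp j hj).trans_lt hdeg
    have hmono : f = C (f.coeff j) * X ^ j := by
      ext i
      rw [coeff_C_mul, coeff_X_pow]
      split_ifs with hij
      · simp [hij]
      · by_contra hi
        simp only [mul_zero] at hi
        have hilt : i < p := (le_natDegree_of_ne_zero hi).trans_lt hdeg
        have h1 := hcoeff i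
        rw [hh0, coeff_zero, eq_comm, mul_eq_zero, or_iff_left hi, sub_eq_zero] at h1
        rw [CharP.cast_eq_iff_mod_eq F p, Nat.mod_eq_of_lt hilt, Nat.mod_eq_of_lt hjlt] at h1
        exact hij h1
    have hroot : f.eval 1 = 0 := by
      obtain ⟨g, rfl⟩ := hdvd
      simp
    rw [hmono] at hroot
    simp at hroot
    exact (mem_support_iff.1 hj) hroot

end Stepanov

/-! ### Stepanov's auxiliary polynomial -/

section Stepanov

open Polynomial

variable {F : Type*} [Field F]

/-- The polynomial `∑ c (a, b) X ^ (a + t * b)`. -/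
noncomputable def lacunaryPoly (t : ℕ) {A B : ℕ} (c : Fin A × Fin B → F) : F[X] :=
  ∑ i, C (c i) * X ^ ((i.1 : ℕ) + t * i.2)

lemma lacunaryExponent_injective {t A B : ℕ} (hA : A ≤ t) :
    Function.Injective (fun i : Fin A × Fin B => (i.1 : ℕ) + t * i.2) := by
  rintro ⟨a, b⟩ ⟨a', b'⟩ h
  simp only at h
  have ha : (a : ℕ) < t := a.2.trans_le hA
  have ha' : (a' : ℕ) < t := a'.2.trans_le hA
  have h1 : (a : ℕ) = a' := by
    have := congrArg (· % t) h
    simpa [Nat.mod_eq_of_lt ha, Nat.mod_eq_of_lt ha'] using this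
  have h2 : (b : ℕ) = b' := by
    rw [h1] at h
    exact Nat.eq_of_mul_eq_mul_left (by omega) (Nat.add_left_cancel h)
  exact Prod.ext (Fin.ext h1) (Fin.ext h2)

lemma coeff_lacunaryPoly {t A B : ℕ} (hA : A ≤ t) (c : Fin A × Fin B → F) (i : Fin A × Fin B) :
    (lacunaryPoly t c).coeff ((i.1 : ℕ) + t * i.2) = c i := by
  rw [lacunaryPoly, finsetSum_coeff, sum_eq_single i]
  · simp
  · intro j _ hj
    rw [coeff_C_mul, coeff_X_pow, if_neg, mul_zero]
    exact fun h => hj (lacunaryExponent_injective hA h.symm)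
  · simp

lemma card_support_lacunaryPoly_le (t : ℕ) {A B : ℕ} (c : Fin A × Fin B → F) :
    #(lacunaryPoly t c).support ≤ A * B := by
  classical
  have : (lacunaryPoly t c).support ⊆
      univ.image (fun i : Fin A × Fin B => (i.1 : ℕ) + t * i.2) := by
    intro n hn
    by_contra hne
    apply mem_support_iff.1 hn
    rw [lacunaryPoly, finsetSum_coeff]
    refine sum_eq_zero fun i _ => ?_
    rw [coeff_C_mul, coeff_X_pow, if_neg, mul_zero]
    rintro rfl
    exact hne (mem_image_of_mem _ (mem_univ i))
  refine (card_le_card this).trans (card_image_le.trans ?_)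
  simp

lemma lacunaryExponent_lt {t A B : ℕ} (i : Fin A × Fin B) :
    (i.1 : ℕ) + t * i.2 < A + t * B := by
  have h1 := i.1.2
  have h2 : t * (i.2 : ℕ) ≤ t * B := Nat.mul_le_mul_left _ i.2.2.le
  omega

lemma natDegree_lacunaryPoly_le (t : ℕ) {A B : ℕ} (c : Fin A × Fin B → F) :
    (lacunaryPoly t c).natDegree ≤ A + t * B - 1 := by
  refine natDegree_sum_le_of_forall_le _ _ fun i _ => ?_
  have := lacunaryExponent_lt (t := t) i
  refine (natDegree_C_mul_X_pow_le _ _).trans ?_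
  omega

/-- Stepanov's auxiliary polynomial `∑ c (a, b, d) X ^ (a + t b) (X - 1) ^ (t d)`. -/
noncomputable def stepanovPoly (t : ℕ) {A B : ℕ} (c : (Fin A × Fin B) × Fin B → F) : F[X] :=
  ∑ d : Fin B, (X - 1) ^ (t * (d : ℕ)) * lacunaryPoly t (fun i => c (i, d))

lemma natDegree_stepanovPoly_le (t : ℕ) {A B : ℕ} (c : (Fin A × Fin B) × Fin B → F) :
    (stepanovPoly t c).natDegree ≤ A + 2 * t * B := by
  refine natDegree_sum_le_of_forall_le _ _ fun d _ => ?_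
  have h1 := natDegree_lacunaryPoly_le t (fun i => c (i, d))
  have h2 : ((X - 1 : F[X]) ^ (t * (d : ℕ))).natDegree ≤ t * B := by
    refine natDegree_pow_le.trans ?_
    have : (X - 1 : F[X]).natDegree ≤ 1 := by simpa using natDegree_X_sub_C_le (1 : F)
    calc t * (d : ℕ) * (X - 1 : F[X]).natDegree ≤ t * d * 1 := Nat.mul_le_mul_left _ this
      _ ≤ t * B := by rw [mul_one]; exact Nat.mul_le_mul_left _ d.2.le
  refine natDegree_mul_le.trans ?_
  have : 2 * t * B = t * B + t * B := by ring
  omega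

/-- The functions `X ^ (a + t b) (X - 1) ^ (t d)` are linearly independent: the lowest power of
`X - 1` with a nonzero coefficient would have a coefficient that vanishes to order `t` at `1`
although it has at most `A B ≤ t` monomials. -/
lemma eq_zero_of_stepanovPoly_eq_zero {p : ℕ} [CharP F p] {t A B : ℕ} (hA : A ≤ t)
    (hAB : A * B ≤ t) (hp : A + t * B ≤ p) (hp0 : 0 < p) {c : (Fin A × Fin B) × Fin B → F}
    (h : stepanovPoly t c = 0) : c = 0 := by
  have key : ∀ n : ℕ, ∀ d : Fin B, (d : ℕ) = n → lacunaryPoly t (fun i => c (i, d)) = 0 := by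
    intro n
    induction n using Nat.strong_induction_on with
    | _ n ih =>
      intro d hd
      apply eq_zero_of_sparse (p := p) t
      · have := natDegree_lacunaryPoly_le t (fun i => c (i, d))
        omega
      · exact (card_support_lacunaryPoly_le t _).trans hAB
      · have hne : ((X - 1 : F[X]) ^ (t * (d : ℕ))) ≠ 0 :=
          pow_ne_zero _ (by simpa using X_sub_C_ne_zero (1 : F))
        refine (mul_dvd_mul_iff_left hne).1 ?_
        rw [stepanovPoly, ← add_sum_erase _ _ (mem_univ d), add_eq_zero_iff_eq_neg] at h
        rw [h, dvd_neg, ← pow_add]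
        refine dvd_sum fun e he => ?_
        rcases lt_trichotomy (e : ℕ) d with hlt | heq | hgt
        · rw [ih e (hd ▸ hlt) e rfl, mul_zero]
          exact dvd_zero _
        · exact absurd (Fin.ext heq) (ne_of_mem_erase he)
        · refine Dvd.dvd.mul_right (pow_dvd_pow _ ?_) _
          calc t * (d : ℕ) + t = t * (d + 1) := by ring
            _ ≤ t * e := Nat.mul_le_mul_left _ hgt
  funext ⟨i, d⟩
  rw [← coeff_lacunaryPoly hA (fun i => c (i, d)) i, key d d rfl]
  simp

/-- On a point with `x ^ t = (x - 1) ^ t = β`, the derivative `eulerOp ^ n` of the auxiliary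
polynomial is the value of a polynomial of degree at most `A + n` that depends only on `β`. -/
lemma eval_eulerOp_pow_stepanovPoly {t A B : ℕ} (c : (Fin A × Fin B) × Fin B → F) (n : ℕ)
    {x β : F} (hx : x ^ t = β) (hx' : (x - 1) ^ t = β) :
    ((eulerOp F ^ n) (stepanovPoly t c)).eval x =
      (∑ d : Fin B, ∑ i : Fin A × Fin B, C (c (i, d) * β ^ ((i.2 : ℕ) + d)) *
        (twistedEulerOp F (t * i.2) (t * d) ^ n) (X ^ (i.1 : ℕ))).eval x := by
  rw [stepanovPoly, map_sum, eval_finsetSum, eval_finsetSum]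
  refine sum_congr rfl fun d _ => ?_
  rw [lacunaryPoly, mul_sum, map_sum, eval_finsetSum, eval_finsetSum]
  refine sum_congr rfl fun i _ => ?_
  have h : (X - 1 : F[X]) ^ (t * (d : ℕ)) * (C (c (i, d)) * X ^ ((i.1 : ℕ) + t * i.2)) =
      c (i, d) • (X ^ (t * (i.2 : ℕ)) * (X - 1) ^ (t * (d : ℕ)) * X ^ (i.1 : ℕ)) := by
    rw [smul_eq_C_mul]; ring
  rw [h, map_smul, eulerOp_pow_mul_pow, eval_smul, eval_mul, eval_mul, eval_mul, eval_C]
  simp only [eval_pow, eval_X, eval_sub, eval_one, smul_eq_mul]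
  rw [pow_mul, pow_mul, hx, hx', pow_add]
  ring

/-- Stepanov's method: the points `x ≠ 0, 1` with `x ^ t = (x - 1) ^ t ∈ T` are all zeros of order
`D` of a nonzero auxiliary polynomial of degree at most `A + 2 t B`. -/
theorem stepanov_bound {p : ℕ} [Fact p.Prime] [CharP F p] {t A B D : ℕ} (hA : A ≤ t)
    (hAB : A * B ≤ t) (hp : A + t * B ≤ p) (hD : D ≤ p) (T S : Finset F)
    (hcount : #T * (D * (A + D)) < A * B * B)
    (hS : ∀ x ∈ S, x ≠ 0 ∧ x ≠ 1 ∧ x ^ t ∈ T ∧ (x - 1) ^ t = x ^ t) :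
    D * #S ≤ A + 2 * t * B := by
  classical
  let Q : T → Fin D → ((Fin A × Fin B) × Fin B) → F[X] := fun β n i =>
    C ((β : F) ^ ((i.1.2 : ℕ) + i.2)) *
      (twistedEulerOp F (t * i.1.2) (t * i.2) ^ (n : ℕ)) (X ^ (i.1.1 : ℕ))
  let M : Matrix (T × Fin D × Fin (A + D)) ((Fin A × Fin B) × Fin B) F :=
    Matrix.of fun r i => (Q r.1 r.2.1 i).coeff r.2.2
  have hker : LinearMap.ker M.mulVecLin ≠ ⊥ := by
    apply LinearMap.ker_ne_bot_of_finrank_lt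
    simpa using hcount
  obtain ⟨c, hc, hc0⟩ := Submodule.exists_mem_ne_zero_of_ne_bot hker
  rw [LinearMap.mem_ker, Matrix.mulVecLin_apply] at hc
  have hP0 : stepanovPoly t c ≠ 0 := fun h =>
    hc0 (eq_zero_of_stepanovPoly_eq_zero hA hAB hp (Fact.out : p.Prime).pos h)
  have hzero : ∀ (β : T) (n : Fin D), ∑ i, C (c i) * Q β n i = 0 := by
    intro β n
    ext r
    rw [coeff_zero]
    rcases lt_or_ge r (A + D) with hr | hr
    · have := congrFun hc (β, n, ⟨r, hr⟩)
      simp only [Matrix.mulVec, dotProduct, M, Matrix.of_apply, Pi.zero_apply] at this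
      rw [finsetSum_coeff, ← this]
      exact sum_congr rfl fun i _ => by rw [coeff_C_mul, mul_comm]
    · rw [finsetSum_coeff]
      refine sum_eq_zero fun i _ => ?_
      rw [coeff_C_mul, coeff_C_mul, coeff_eq_zero_of_natDegree_lt, mul_zero, mul_zero]
      have h1 := natDegree_twistedEulerOp_pow_le (n : ℕ) (t * i.1.2) (t * i.2)
        (X ^ (i.1.1 : ℕ) : F[X])
      rw [natDegree_X_pow] at h1
      have := i.1.1.2
      have := n.2
      omega
  have hdvd : ∏ x ∈ S, (X - C x) ^ D ∣ stepanovPoly t c := by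
    refine Finset.prod_dvd_of_coprime ?_ ?_
    · intro x _ y _ hxy
      exact (pairwise_coprime_X_sub_C Function.injective_id hxy).pow
    · intro x hx
      obtain ⟨h0, h1, hT, he⟩ := hS x hx
      refine X_sub_C_pow_dvd_of_eulerOp (p := p) hD h0 h1 fun n hn => ?_
      rw [eval_eulerOp_pow_stepanovPoly c n rfl he]
      have := hzero ⟨_, hT⟩ ⟨n, hn⟩
      rw [Fintype.sum_prod_type_right] at this
      rw [← eval_zero (x := x), ← this]
      congr 1
      refine sum_congr rfl fun d _ => sum_congr rfl fun i _ => ?_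
      simp only [Q, C_mul]
      ring
  have hdeg := natDegree_le_of_dvd hdvd hP0
  rw [natDegree_prod_of_monic _ _ fun x _ => (monic_X_sub_C x).pow D] at hdeg
  simp only [natDegree_pow, natDegree_X_sub_C, mul_one, sum_const, smul_eq_mul] at hdeg
  rw [mul_comm]
  exact hdeg.trans (natDegree_stepanovPoly_le t c)

end Stepanov

/-! ### The additive energy of a group of roots of unity -/

section Energy

variable {F : Type*} [Field F] [Fintype F] [DecidableEq F]

variable (F) in
/-- The `t`-th roots of unity of a finite field (the whole field if `t = 0`). -/
def unityRoots (t : ℕ) : Finset F := {x | x ^ t = 1}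

@[simp] lemma mem_unityRoots {t : ℕ} {x : F} : x ∈ unityRoots F t ↔ x ^ t = 1 := by
  simp [unityRoots]

/-- The points `x ≠ 0, 1` with `x ^ t = (x - 1) ^ t = β`; they parametrize the representations of
`u`, where `β = u⁻¹ ^ t`, as a difference of two `t`-th roots of unity. -/
def shiftedPowerFiber (t : ℕ) (β : F) : Finset F :=
  {x | x ≠ 0 ∧ x ≠ 1 ∧ x ^ t = β ∧ (x - 1) ^ t = x ^ t}

lemma mem_shiftedPowerFiber {t : ℕ} {β x : F} :
    x ∈ shiftedPowerFiber t β ↔ x ≠ 0 ∧ x ≠ 1 ∧ x ^ t = β ∧ (x - 1) ^ t = x ^ t := by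
  simp [shiftedPowerFiber]

lemma card_pow_eq_le {t : ℕ} (ht : 0 < t) (β : F) : #{x : F | x ^ t = β} ≤ t := by
  have : ({x : F | x ^ t = β} : Finset F) ⊆ (Polynomial.nthRoots t β).toFinset := by
    intro x hx
    rw [Multiset.mem_toFinset, Polynomial.mem_nthRoots ht]
    simpa using hx
  exact (card_le_card this).trans
    ((Multiset.toFinset_card_le _).trans (Polynomial.card_nthRoots t β))

lemma sum_card_shiftedPowerFiber (t : ℕ) (T : Finset F) :
    ∑ β ∈ T, #(shiftedPowerFiber t β) = #(T.biUnion (shiftedPowerFiber t)) := by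
  rw [card_biUnion]
  intro β _ γ _ hne
  rw [Function.onFun, disjoint_left]
  intro x hx hx'
  rw [mem_shiftedPowerFiber] at hx hx'
  exact hne (hx.2.2.1.symm.trans hx'.2.2.1)

lemma sum_card_shiftedPowerFiber_le {t : ℕ} (ht : 0 < t) (T : Finset F) :
    ∑ β ∈ T, #(shiftedPowerFiber t β) ≤ t := by
  rw [sum_card_shiftedPowerFiber]
  refine (card_le_card_of_injOn (fun x => x / (x - 1)) ?_ ?_).trans (card_pow_eq_le ht (1 : F))
  · intro x hx
    obtain ⟨β, _, hβ⟩ := mem_biUnion.1 hx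
    rw [mem_shiftedPowerFiber] at hβ
    simp only [coe_filter, mem_univ, true_and, Set.mem_ofPred_eq]
    rw [div_pow, hβ.2.2.2, div_self (pow_ne_zero _ hβ.1)]
  · intro x hx y hy hxy
    obtain ⟨β, _, hβ⟩ := mem_biUnion.1 hx
    obtain ⟨γ, _, hγ⟩ := mem_biUnion.1 hy
    rw [mem_shiftedPowerFiber] at hβ hγ
    have h1 := sub_ne_zero.2 hβ.2.1
    have h2 := sub_ne_zero.2 hγ.2.1
    simp only at hxy
    rw [div_eq_div_iff h1 h2] at hxy
    linear_combination -hxy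

lemma exists_cube_between {n : ℕ} (hn : 1 ≤ n) : ∃ B : ℕ, 2 ≤ B ∧ n < B ^ 3 ∧ B ^ 3 ≤ 8 * n := by
  have hex : ∃ B : ℕ, n < B ^ 3 := ⟨n + 1, by nlinarith [Nat.zero_le (n ^ 3), Nat.zero_le (n ^ 2)]⟩
  classical
  have h1 := Nat.find_spec hex
  have h2 : 2 ≤ Nat.find hex := by
    by_contra hlt
    have : Nat.find hex ≤ 1 := by omega
    have := Nat.pow_le_pow_left this 3
    omega
  refine ⟨Nat.find hex, h2, h1, ?_⟩
  have h3 := Nat.find_min hex (m := Nat.find hex - 1) (by omega)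
  have h4 : Nat.find hex ≤ 2 * (Nat.find hex - 1) := by omega
  calc Nat.find hex ^ 3 ≤ (2 * (Nat.find hex - 1)) ^ 3 := Nat.pow_le_pow_left h4 3
    _ = 8 * (Nat.find hex - 1) ^ 3 := by ring
    _ ≤ 8 * n := by omega

/-- The Heath-Brown–Konyagin bound for the number of differences in `#T` cosets. The parameters of
Stepanov's method are `B ≈ (2 #T t) ^ (1 / 3)` and `A = D ≈ t / B`. -/
lemma sum_card_shiftedPowerFiber_cube_le {p : ℕ} [Fact p.Prime] [CharP F p] {t : ℕ} (ht : 16 ≤ t)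
    {T : Finset F} (hT : #T ≤ t) (hp : 128 * #T * t ^ 4 ≤ p ^ 3) :
    (∑ β ∈ T, #(shiftedPowerFiber t β)) ^ 3 ≤ 32000 * #T ^ 2 * t ^ 2 := by
  rcases T.eq_empty_or_nonempty with rfl | hne
  · simp
  set m := #T with hm
  have hm1 : 1 ≤ m := hne.card_pos
  obtain ⟨B, hB2, hB, hB'⟩ := exists_cube_between (n := 2 * (m * t)) (by nlinarith)
  have hBt : B ≤ t := by
    apply le_of_pow_le_pow_left₀ (n := 3) (by norm_num) (by omega)
    calc B ^ 3 ≤ 8 * (2 * (m * t)) := hB'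
      _ = 16 * m * t := by ring
      _ ≤ t * t * t := by gcongr
      _ = t ^ 3 := by ring
  set A := t / B with hA
  have hA1 : 1 ≤ A := (Nat.one_le_div_iff (by omega)).2 hBt
  have hAB : A * B ≤ t := Nat.div_mul_le_self t B
  have hAt : A ≤ t := Nat.div_le_self t B
  have hAB2 : t ≤ 2 * (A * B) := by
    have h1 := Nat.lt_div_mul_add (a := t) (b := B) (by omega)
    have h2 : B ≤ A * B := Nat.le_mul_of_pos_left B hA1
    rw [← hA] at h1
    omega
  have hpB : A + t * B ≤ p := by
    apply le_of_pow_le_pow_left₀ (n := 3) (by norm_num) (by omega)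
    calc (A + t * B) ^ 3 ≤ (2 * t * B) ^ 3 := by
          apply Nat.pow_le_pow_left
          nlinarith
      _ = 8 * t ^ 3 * B ^ 3 := by ring
      _ ≤ 8 * t ^ 3 * (8 * (2 * (m * t))) := by gcongr
      _ = 128 * m * t ^ 4 := by ring
      _ ≤ p ^ 3 := hp
  have hcount : m * (A * (A + A)) < A * B * B := by
    have h1 : 2 * m * (A * B) < B * B * B := by
      calc 2 * m * (A * B) ≤ 2 * m * t := by gcongr
        _ < B * B * B := by linarith [hB, show B ^ 3 = B * B * B by ring]
    have h2 : 2 * m * A < B * B := by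
      by_contra hcon
      have := Nat.mul_le_mul_right B (not_lt.1 hcon)
      linarith
    nlinarith
  have key := stepanov_bound (p := p) hAt hAB hpB (D := A) (by omega) T
    (T.biUnion (shiftedPowerFiber t)) hcount (by
      intro x hx
      obtain ⟨β, hβT, hβ⟩ := mem_biUnion.1 hx
      rw [mem_shiftedPowerFiber] at hβ
      exact ⟨hβ.1, hβ.2.1, hβ.2.2.1 ▸ hβT, hβ.2.2.2⟩)
  rw [sum_card_shiftedPowerFiber]
  set s := #(T.biUnion (shiftedPowerFiber t))
  have hs : s ≤ 5 * B ^ 2 := by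
    have h1 : t * s ≤ t * (2 + 4 * B ^ 2) := by
      calc t * s ≤ 2 * (A * B) * s := by gcongr
        _ = 2 * B * (A * s) := by ring
        _ ≤ 2 * B * (A + 2 * t * B) := by gcongr
        _ = 2 * (A * B) + 4 * t * B ^ 2 := by ring
        _ ≤ 2 * t + 4 * t * B ^ 2 := by gcongr
        _ = t * (2 + 4 * B ^ 2) := by ring
    have h2 := Nat.le_of_mul_le_mul_left h1 (by omega)
    nlinarith
  calc s ^ 3 ≤ (5 * B ^ 2) ^ 3 := Nat.pow_le_pow_left hs 3
    _ = 125 * (B ^ 3) ^ 2 := by ring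
    _ ≤ 125 * (8 * (2 * (m * t))) ^ 2 := by gcongr
    _ = 32000 * m ^ 2 * t ^ 2 := by ring

/-- At most `O(t ^ 2 / l ^ 3)` of the fibres have at least `l` elements, for `l` beyond a multiple
of `√t`. -/
lemma card_large_shiftedPowerFiber {p : ℕ} [Fact p.Prime] [CharP F p] {t : ℕ} (ht : 16 ≤ t)
    (hp : 2 ^ 16 * t ^ 9 ≤ p ^ 6) {l : ℕ} (hl : 1024 * t ≤ l ^ 2) :
    #{β : F | l ≤ #(shiftedPowerFiber t β)} * l ^ 3 ≤ 32000 * t ^ 2 := by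
  have hsub : ∀ T : Finset F, T ⊆ ({β : F | l ≤ #(shiftedPowerFiber t β)} : Finset F) →
      #T ≤ t.sqrt + 1 → #T * l ^ 3 ≤ 32000 * t ^ 2 := by
    intro T hT hcard
    have hsq : t.sqrt ^ 2 ≤ t := Nat.sqrt_le' t
    have hsq4 : 4 ≤ t.sqrt := Nat.le_sqrt.2 ht
    have hT2 : #T ^ 2 ≤ 4 * t := by nlinarith
    have hTt : #T ≤ t := by nlinarith
    have hpT : 128 * #T * t ^ 4 ≤ p ^ 3 := by
      apply le_of_pow_le_pow_left₀ (n := 2) (by norm_num) (by positivity)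
      calc (128 * #T * t ^ 4) ^ 2 = 2 ^ 14 * t ^ 8 * #T ^ 2 := by ring
        _ ≤ 2 ^ 14 * t ^ 8 * (4 * t) := by gcongr
        _ = 2 ^ 16 * t ^ 9 := by ring
        _ ≤ (p ^ 3) ^ 2 := by rw [← pow_mul]; exact hp
    have h1 := sum_card_shiftedPowerFiber_cube_le (p := p) ht hTt hpT
    have h2 : #T * l ≤ ∑ β ∈ T, #(shiftedPowerFiber t β) := by
      rw [← smul_eq_mul]
      exact card_nsmul_le_sum _ _ _ fun β hβ => (mem_filter.1 (hT hβ)).2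
    rcases T.eq_empty_or_nonempty with rfl | hne
    · simp
    have h3 : #T ^ 2 * (#T * l ^ 3) ≤ #T ^ 2 * (32000 * t ^ 2) := by
      calc #T ^ 2 * (#T * l ^ 3) = (#T * l) ^ 3 := by ring
        _ ≤ _ := (Nat.pow_le_pow_left h2 3).trans h1
        _ = _ := by ring
    exact Nat.le_of_mul_le_mul_left h3 (pow_pos hne.card_pos 2)
  by_cases hle : #{β : F | l ≤ #(shiftedPowerFiber t β)} ≤ t.sqrt + 1
  · exact hsub _ le_rfl hle
  · -- A subset of more than `√t` elements would contradict the bound.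
    exfalso
    obtain ⟨T, hT, hTc⟩ := exists_subset_card_eq (not_le.1 hle).le
    have h1 := hsub T hT hTc.le
    rw [hTc] at h1
    have h2 : t < (t.sqrt + 1) ^ 2 := Nat.lt_succ_sqrt' t
    have h3 := Nat.pow_le_pow_left h1 2
    have h4 : t * (1024 * t) ^ 3 ≤ ((t.sqrt + 1) * l ^ 3) ^ 2 := by
      calc t * (1024 * t) ^ 3 ≤ (t.sqrt + 1) ^ 2 * (l ^ 2) ^ 3 := by gcongr
        _ = _ := by ring
    have h5 : 0 < t ^ 4 := by positivity
    nlinarith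

lemma sq_le_layer_cake (l n : ℕ) : n ^ 2 ≤ l * n + ∑ k ∈ Ioc l n, 2 * k := by
  induction n with
  | zero => simp
  | succ n ih =>
    rcases le_or_gt (n + 1) l with h | h
    · nlinarith [Nat.zero_le (∑ k ∈ Ioc l (n + 1), 2 * k)]
    · rw [sum_Ioc_succ_top (by omega)]
      nlinarith

lemma sum_sq_card_shiftedPowerFiber_le {p : ℕ} [Fact p.Prime] [CharP F p] {t : ℕ} (ht : 16 ≤ t)
    (hp : 2 ^ 16 * t ^ 9 ≤ p ^ 6) :
    (∑ β : F, (#(shiftedPowerFiber t β) : ℝ) ^ 2) ≤ 5000 * t * √t := by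
  set l := 32 * (t.sqrt + 1) with hl
  have hll : 1024 * t ≤ l ^ 2 := by
    have := Nat.lt_succ_sqrt' t
    rw [hl, mul_pow]
    simp only [Nat.succ_eq_add_one] at this
    omega
  have hn : ∀ β : F, #(shiftedPowerFiber t β) ≤ t := fun β =>
    (single_le_sum (f := fun β => #(shiftedPowerFiber t β)) (fun _ _ => Nat.zero_le _)
      (mem_univ β)).trans (sum_card_shiftedPowerFiber_le (by omega) univ)
  have h1 : ∑ β : F, #(shiftedPowerFiber t β) ^ 2 ≤
      l * t + ∑ k ∈ Ioc l t, 2 * k * #{β : F | k ≤ #(shiftedPowerFiber t β)} := by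
    calc ∑ β : F, #(shiftedPowerFiber t β) ^ 2
        ≤ ∑ β : F, (l * #(shiftedPowerFiber t β) +
          ∑ k ∈ Ioc l #(shiftedPowerFiber t β), 2 * k) :=
          sum_le_sum fun β _ => sq_le_layer_cake _ _
      _ = l * ∑ β : F, #(shiftedPowerFiber t β) +
          ∑ β : F, ∑ k ∈ Ioc l t, if k ≤ #(shiftedPowerFiber t β) then 2 * k else 0 := by
          rw [sum_add_distrib, mul_sum]
          congr 1
          refine sum_congr rfl fun β _ => ?_
          rw [← sum_filter]
          congr 1
          ext k
          have := hn β
          simp only [mem_Ioc, mem_filter]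
          omega
      _ ≤ l * t + ∑ k ∈ Ioc l t, 2 * k * #{β : F | k ≤ #(shiftedPowerFiber t β)} := by
          refine add_le_add (Nat.mul_le_mul_left _ (sum_card_shiftedPowerFiber_le (by omega) _)) ?_
          rw [sum_comm]
          refine sum_le_sum fun k _ => ?_
          rw [← sum_filter, sum_const, smul_eq_mul, mul_comm]
  have h2 : ∀ k ∈ Ioc l t, ((2 * k * #{β : F | k ≤ #(shiftedPowerFiber t β)} : ℕ) : ℝ) ≤
      64000 * (t : ℝ) ^ 2 * ((k : ℝ) ^ 2)⁻¹ := by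
    intro k hk
    rw [mem_Ioc] at hk
    have hk0 : (0 : ℝ) < k := by exact_mod_cast (show 0 < k by omega)
    have h3 := card_large_shiftedPowerFiber (F := F) (p := p) ht hp (l := k)
      (hll.trans (Nat.pow_le_pow_left hk.1.le 2))
    have h4 : (#{β : F | k ≤ #(shiftedPowerFiber t β)} : ℝ) * k ^ 3 ≤ 32000 * t ^ 2 := by
      exact_mod_cast h3
    rw [← div_eq_mul_inv, le_div_iff₀ (by positivity)]
    push_cast
    nlinarith
  have hs : 0 < √(t : ℝ) := Real.sqrt_pos.2 (by exact_mod_cast (show 0 < t by omega))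
  have hss : √(t : ℝ) * √t = t := Real.mul_self_sqrt (by positivity)
  have hs1 : 1 ≤ √(t : ℝ) := Real.one_le_sqrt.2 (by exact_mod_cast (show 1 ≤ t by omega))
  have hlow : 32 * √(t : ℝ) ≤ l := by
    have := Real.real_sqrt_le_nat_sqrt_succ (a := t)
    rw [hl]
    push_cast
    linarith
  have hup : (l : ℝ) ≤ 64 * √t := by
    have := Real.nat_sqrt_le_real_sqrt (a := t)
    rw [hl]
    push_cast
    linarith
  have h5 : ∑ k ∈ Ioc l t, ((k : ℝ) ^ 2)⁻¹ ≤ 2 / (l + 1) := by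
    refine le_trans ?_ (sum_Ioo_inv_sq_le l (t + 1))
    refine le_of_eq (sum_congr ?_ fun _ _ => rfl)
    ext k; simp only [mem_Ioc, mem_Ioo]; omega
  have h6 : (2 : ℝ) / (l + 1) ≤ 2 / (32 * √t) := by gcongr; linarith
  calc (∑ β : F, (#(shiftedPowerFiber t β) : ℝ) ^ 2)
      = ((∑ β : F, #(shiftedPowerFiber t β) ^ 2 : ℕ) : ℝ) := by push_cast; rfl
    _ ≤ ((l * t + ∑ k ∈ Ioc l t, 2 * k * #{β : F | k ≤ #(shiftedPowerFiber t β)} : ℕ) : ℝ) := by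
        exact_mod_cast h1
    _ ≤ l * t + ∑ k ∈ Ioc l t, 64000 * (t : ℝ) ^ 2 * ((k : ℝ) ^ 2)⁻¹ := by
        rw [Nat.cast_add, Nat.cast_mul, Nat.cast_sum]
        gcongr with k hk
        exact h2 k hk
    _ ≤ 64 * √t * t + 64000 * (t : ℝ) ^ 2 * (2 / (32 * √t)) := by
        rw [← mul_sum]
        gcongr
        exact h5.trans h6
    _ = 64 * √t * t + 4000 * t * √t := by
        congr 1
        field_simp
        nlinarith
    _ ≤ 5000 * t * √t := by
        have : 0 ≤ (t : ℝ) * √t := by positivity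
        nlinarith

/-- The number of representations of `u` as a difference of two `t`-th roots of unity. -/
def diffCount (t : ℕ) (u : F) : ℕ :=
  #{x ∈ unityRoots F t ×ˢ unityRoots F t | x.1 - x.2 = u}

lemma diffCount_le {t : ℕ} (ht : 0 < t) {u : F} (hu : u ≠ 0) :
    diffCount t u ≤ #(shiftedPowerFiber t (u⁻¹ ^ t)) := by
  refine card_le_card_of_injOn (fun x => x.1 * u⁻¹) ?_ ?_
  · rintro ⟨x, y⟩ h
    simp only [coe_filter, mem_product, mem_unityRoots, Set.mem_ofPred_eq] at h
    obtain ⟨⟨hx, hy⟩, hxy⟩ := h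
    have hx0 : x ≠ 0 := by rintro rfl; simp [ht.ne'] at hx
    have hy0 : y ≠ 0 := by rintro rfl; simp [ht.ne'] at hy
    have he : x * u⁻¹ - 1 = y * u⁻¹ := by
      rw [← hxy] at hu ⊢
      field_simp
      ring
    simp only [mem_coe]
    rw [mem_shiftedPowerFiber]
    refine ⟨by positivity, ?_, by rw [mul_pow, hx, one_mul], ?_⟩
    · intro h1
      rw [h1, sub_self] at he
      exact mul_ne_zero hy0 (inv_ne_zero hu) he.symm
    · rw [he, mul_pow, mul_pow, hx, hy]
  · rintro ⟨x, y⟩ h ⟨x', y'⟩ h' he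
    simp only [coe_filter, mem_product, mem_unityRoots, Set.mem_ofPred_eq] at h h'
    simp only at he
    have hxx : x = x' := mul_right_cancel₀ (inv_ne_zero hu) he
    refine Prod.ext hxx ?_
    simp only
    linear_combination hxx - h.2 + h'.2

lemma diffCount_zero_le {t : ℕ} (ht : 0 < t) : diffCount t (0 : F) ≤ t := by
  refine (card_le_card_of_injOn Prod.fst ?_ ?_).trans (card_pow_eq_le ht (1 : F))
  · rintro ⟨x, y⟩ h
    simp only [coe_filter, mem_product, mem_unityRoots, Set.mem_ofPred_eq] at h
    simpa using h.1.1
  · rintro ⟨x, y⟩ h ⟨x', y'⟩ h' he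
    simp only [coe_filter, mem_product, mem_unityRoots, Set.mem_ofPred_eq, sub_eq_zero] at h h' he
    exact Prod.ext he (h.2.symm.trans (he.trans h'.2))

/-- The additive energy of the group of `t`-th roots of unity is `O(t ^ (5 / 2))`. -/
theorem sum_sq_diffCount_le {p : ℕ} [Fact p.Prime] [CharP F p] {t : ℕ} (ht : 16 ≤ t)
    (hp : 2 ^ 16 * t ^ 9 ≤ p ^ 6) :
    ∑ u : F, (diffCount t u : ℝ) ^ 2 ≤ 5001 * t ^ 2 * √t := by
  have ht0 : 0 < t := by omega
  have hs1 : 1 ≤ √(t : ℝ) := Real.one_le_sqrt.2 (by exact_mod_cast (show 1 ≤ t by omega))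
  have h0 : (diffCount t (0 : F) : ℝ) ≤ t := by
    exact_mod_cast diffCount_zero_le (F := F) ht0
  have h1 : ∑ u ∈ univ.erase (0 : F), (diffCount t u : ℝ) ^ 2 ≤
      ∑ u : F, (#(shiftedPowerFiber t (u⁻¹ ^ t)) : ℝ) ^ 2 := by
    refine (sum_le_sum (g := fun u => (#(shiftedPowerFiber t (u⁻¹ ^ t)) : ℝ) ^ 2)
      fun u hu => ?_).trans
      (sum_le_sum_of_subset_of_nonneg (subset_univ _) fun _ _ _ => by positivity)
    gcongr
    exact diffCount_le ht0 (ne_of_mem_erase hu)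
  have h2 : ∑ u : F, (#(shiftedPowerFiber t (u⁻¹ ^ t)) : ℝ) ^ 2 ≤
      t * ∑ β : F, (#(shiftedPowerFiber t β) : ℝ) ^ 2 := by
    rw [← sum_fiberwise univ (fun u : F => u⁻¹ ^ t), mul_sum]
    refine sum_le_sum fun β _ => ?_
    rw [sum_congr rfl (g := fun _ => (#(shiftedPowerFiber t β) : ℝ) ^ 2)
      (fun u hu => by rw [(mem_filter.1 hu).2]), sum_const, nsmul_eq_mul]
    gcongr
    refine (card_le_card_of_injOn (fun u => u⁻¹) ?_ inv_injective.injOn).trans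
      (card_pow_eq_le ht0 β)
    intro u hu
    simpa using hu
  rw [← add_sum_erase _ _ (mem_univ (0 : F))]
  have h3 := sum_sq_card_shiftedPowerFiber_le (F := F) (p := p) ht hp
  have ht' : (0 : ℝ) ≤ t := by positivity
  have h4 : (t : ℝ) * ∑ β : F, (#(shiftedPowerFiber t β) : ℝ) ^ 2 ≤ t * (5000 * t * √t) := by
    gcongr
  have h5 : (diffCount t (0 : F) : ℝ) ^ 2 ≤ t ^ 2 := by gcongr
  have h6 : (t : ℝ) ^ 2 ≤ t ^ 2 * √t := le_mul_of_one_le_right (by positivity) hs1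
  nlinarith

end Energy

/-! ### The divisor bound -/

section DivisorBound

lemma exists_nat_add_one_le_rpow {η : ℝ} (hη : 0 < η) :
    ∃ C : ℝ, 1 ≤ C ∧ ∀ e : ℕ, (e : ℝ) + 1 ≤ C * ((2 : ℝ) ^ e) ^ η := by
  have hl : 0 < η * Real.log 2 := mul_pos hη (Real.log_pos one_lt_two)
  refine ⟨1 + (η * Real.log 2)⁻¹, by linarith [inv_pos.2 hl], fun e => ?_⟩
  have h1 : ((2 : ℝ) ^ e) ^ η = Real.exp (η * Real.log 2 * e) := by
    rw [Real.rpow_def_of_pos (by positivity), Real.log_pow]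
    ring_nf
  have h2 := Real.add_one_le_exp (η * Real.log 2 * e)
  have h3 : (η * Real.log 2)⁻¹ * (η * Real.log 2 * e) = e := by
    rw [← mul_assoc, inv_mul_cancel₀ hl.ne', one_mul]
  calc (e : ℝ) + 1 ≤ (1 + (η * Real.log 2)⁻¹) * (η * Real.log 2 * e + 1) := by
        have : 0 ≤ η * Real.log 2 * e := by positivity
        have := inv_pos.2 hl
        nlinarith
    _ ≤ _ := by rw [h1]; gcongr

/-- The divisor bound `τ(n) = O(n ^ η)`. -/
theorem exists_card_divisors_le {η : ℝ} (hη : 0 < η) :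
    ∃ C : ℝ, 1 ≤ C ∧ ∀ n : ℕ, n ≠ 0 → (#n.divisors : ℝ) ≤ C * (n : ℝ) ^ η := by
  obtain ⟨C, hC, hCe⟩ := exists_nat_add_one_le_rpow hη
  obtain ⟨Q, hQ⟩ := exists_nat_ge ((2 : ℝ) ^ η⁻¹)
  have hQ2 : ∀ q : ℕ, Q ≤ q → (2 : ℝ) ≤ (q : ℝ) ^ η := by
    intro q hq
    calc (2 : ℝ) = ((2 : ℝ) ^ η⁻¹) ^ η := by
          rw [← Real.rpow_mul (by norm_num), inv_mul_cancel₀ hη.ne', Real.rpow_one]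
      _ ≤ (q : ℝ) ^ η := by
          gcongr
          exact hQ.trans (by exact_mod_cast hq)
  refine ⟨C ^ Q, one_le_pow₀ hC, fun n hn => ?_⟩
  have hfac : (n : ℝ) ^ η = ∏ q ∈ n.primeFactors, ((q : ℝ) ^ n.factorization q) ^ η := by
    rw [Real.finsetProd_rpow _ _ fun q _ => by positivity]
    congr 1
    conv_lhs => rw [← Nat.prod_factorization_pow_eq_self hn, Finsupp.prod, Nat.cast_prod]
    simp
  rw [Nat.card_divisors hn, hfac]
  -- Only the primes `q < Q` contribute a factor `C`.
  have hprime : ∀ q ∈ n.primeFactors, ((n.factorization q + 1 : ℕ) : ℝ) ≤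
      (if q < Q then C else 1) * ((q : ℝ) ^ n.factorization q) ^ η := by
    intro q hq
    have hq2 : (2 : ℝ) ≤ q := by exact_mod_cast (Nat.prime_of_mem_primeFactors hq).two_le
    push_cast
    split_ifs with h
    · refine (hCe _).trans ?_
      gcongr
    · rw [one_mul, ← Real.rpow_natCast_mul (by positivity), mul_comm, Real.rpow_mul_natCast
        (by positivity)]
      calc (n.factorization q : ℝ) + 1 ≤ 2 ^ n.factorization q := by
            exact_mod_cast Nat.lt_two_pow_self
        _ ≤ _ := by
            gcongr
            exact hQ2 q (not_lt.1 h)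
  push_cast at hprime ⊢
  refine (prod_le_prod (fun q _ => by positivity) hprime).trans ?_
  rw [prod_mul_distrib]
  gcongr
  rw [prod_ite, prod_const_one, mul_one, prod_const]
  refine pow_le_pow_right₀ hC ?_
  calc #{q ∈ n.primeFactors | q < Q} ≤ #(range Q) := card_le_card fun q hq => by
        simpa using (mem_filter.1 hq).2
    _ = Q := card_range Q

end DivisorBound

/-! ### Fractions in a group of roots of unity -/

section PowCount

/-- The number of pairs `a, b ≤ Z` of positive integers with `a ^ t ≡ b ^ t (mod p)`. -/
def powCount (p t Z : ℕ) : ℕ :=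
  #{x ∈ Icc 1 Z ×ˢ Icc 1 Z | (x.1 : ZMod p) ^ t = (x.2 : ZMod p) ^ t}

/-- The number of coprime pairs among those counted by `powCount`. -/
def coprimePowCount (p t Z : ℕ) : ℕ :=
  #{x ∈ Icc 1 Z ×ˢ Icc 1 Z | (x.1 : ZMod p) ^ t = (x.2 : ZMod p) ^ t ∧ x.1.Coprime x.2}

variable {p t : ℕ}

lemma natCast_ne_zero_of_mem_Icc {a Z : ℕ} (ha : a ∈ Icc 1 Z) (hZ : Z < p) : (a : ZMod p) ≠ 0 := by
  rw [mem_Icc] at ha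
  rw [Ne, ZMod.natCast_eq_zero_iff]
  exact fun h => absurd (Nat.le_of_dvd (by omega) h) (by omega)

lemma coprimePowCount_le_powCount (Z : ℕ) : coprimePowCount p t Z ≤ powCount p t Z :=
  card_le_card fun x hx => by
    simp only [mem_filter] at hx ⊢
    exact ⟨hx.1, hx.2.1⟩

lemma powCount_le_sq (Z : ℕ) : powCount p t Z ≤ Z ^ 2 := by
  refine (card_filter_le _ _).trans ?_
  simp [sq]

/-- Pairs may be multiplied coordinatewise, and each product arises from few factorizations. -/
lemma powCount_mul_powCount_le {D Y Z : ℕ} (hD : ∀ n, n ≠ 0 → n ≤ Y * Z → #n.divisors ≤ D) :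
    powCount p t Y * powCount p t Z ≤ D ^ 2 * powCount p t (Y * Z) := by
  rw [powCount, powCount, ← card_product]
  refine card_le_mul_card_image_of_maps_to
    (f := fun x : (ℕ × ℕ) × ℕ × ℕ => (x.1.1 * x.2.1, x.1.2 * x.2.2)) ?_ _ ?_
  · rintro ⟨⟨a, b⟩, c, d⟩ h
    simp only [mem_product, mem_filter, mem_Icc] at h ⊢
    obtain ⟨⟨⟨⟨ha, ha'⟩, hb, hb'⟩, hab⟩, ⟨⟨hc, hc'⟩, hd, hd'⟩, hcd⟩ := h
    refine ⟨⟨⟨Nat.mul_pos ha hc, Nat.mul_le_mul ha' hc'⟩,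
      Nat.mul_pos hb hd, Nat.mul_le_mul hb' hd'⟩, ?_⟩
    push_cast
    rw [mul_pow, mul_pow, hab, hcd]
  · rintro ⟨m, n⟩ h
    simp only [mem_product, mem_filter, mem_Icc] at h
    obtain ⟨⟨⟨hm, hm'⟩, hn, hn'⟩, -⟩ := h
    calc _ ≤ #(m.divisors ×ˢ n.divisors) := by
          refine card_le_card_of_injOn Prod.fst ?_ ?_
          · rintro ⟨⟨a, b⟩, c, d⟩ h
            simp only [coe_filter, Set.mem_ofPred_eq, Prod.mk.injEq] at h
            simp only [coe_product, Set.mem_prod, mem_coe, Nat.mem_divisors]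
            exact ⟨⟨⟨c, h.2.1.symm⟩, by omega⟩, ⟨d, h.2.2.symm⟩, by omega⟩
          · rintro ⟨⟨a, b⟩, c, d⟩ h ⟨⟨a', b'⟩, c', d'⟩ h' he
            simp only [coe_filter, Set.mem_ofPred_eq, Prod.mk.injEq, mem_product, mem_filter,
              mem_Icc] at h h' he ⊢
            obtain ⟨rfl, rfl⟩ := he
            refine ⟨⟨rfl, rfl⟩, Nat.eq_of_mul_eq_mul_left (by omega) (h.2.1.trans h'.2.1.symm),
              Nat.eq_of_mul_eq_mul_left (by omega) (h.2.2.trans h'.2.2.symm)⟩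
      _ ≤ D ^ 2 := by
          rw [card_product, sq]
          exact Nat.mul_le_mul (hD m (by omega) hm') (hD n (by omega) hn')

/-- Sorting pairs by their greatest common divisor. -/
lemma powCount_le_sum [Fact p.Prime] {R : ℕ} (hR : R < p) :
    powCount p t R ≤ ∑ d ∈ Icc 1 R, coprimePowCount p t (R / d) := by
  rw [powCount, card_eq_sum_card_fiberwise (f := fun x : ℕ × ℕ => x.1.gcd x.2) (t := Icc 1 R)]
  · refine sum_le_sum fun d hd => ?_
    have hd0 := natCast_ne_zero_of_mem_Icc hd hR
    rw [mem_Icc] at hd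
    refine card_le_card_of_injOn (fun x => (x.1 / d, x.2 / d)) ?_ ?_
    · rintro ⟨a, b⟩ h
      simp only [coe_filter, mem_filter, mem_product, mem_Icc, Set.mem_ofPred_eq] at h ⊢
      obtain ⟨⟨⟨⟨ha, ha'⟩, hb, hb'⟩, hab⟩, rfl⟩ := h
      have h1 := Nat.div_mul_cancel (Nat.gcd_dvd_left a b)
      have h2 := Nat.div_mul_cancel (Nat.gcd_dvd_right a b)
      refine ⟨⟨⟨Nat.div_pos (Nat.gcd_le_left _ (by omega)) (by omega),
        Nat.div_le_div_right ha'⟩, Nat.div_pos (Nat.gcd_le_right _ (by omega)) (by omega),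
        Nat.div_le_div_right hb'⟩, ?_, Nat.coprime_div_gcd_div_gcd (by omega)⟩
      rw [← h1, ← h2] at hab
      push_cast at hab
      rw [mul_pow, mul_pow] at hab
      exact mul_right_cancel₀ (pow_ne_zero t hd0) (by simpa [h1, h2] using hab)
    · rintro ⟨a, b⟩ h ⟨a', b'⟩ h' he
      simp only [coe_filter, mem_filter, Set.mem_ofPred_eq, Prod.mk.injEq] at h h' he ⊢
      have ha : d ∣ a := h.2 ▸ Nat.gcd_dvd_left a b
      have hb : d ∣ b := h.2 ▸ Nat.gcd_dvd_right a b
      have ha' : d ∣ a' := h'.2 ▸ Nat.gcd_dvd_left a' b'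
      have hb' : d ∣ b' := h'.2 ▸ Nat.gcd_dvd_right a' b'
      exact ⟨(Nat.div_left_inj ha ha').1 he.1, (Nat.div_left_inj hb hb').1 he.2⟩
  · rintro ⟨a, b⟩ h
    simp only [coe_filter, mem_product, mem_Icc, Set.mem_ofPred_eq, coe_Icc, Set.mem_Icc] at h ⊢
    exact ⟨Nat.gcd_pos_of_pos_left _ (by omega), (Nat.gcd_le_left _ (by omega)).trans h.1.1.2⟩

/-- Distinct fractions `a / b ≤ 1` of height at most `W` in the same residue class modulo `p` are at
least `p / W ^ 2` apart. -/
lemma card_coprime_fractions_le [Fact p.Prime] {W : ℕ} (lam : ZMod p) :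
    #{x ∈ Icc 1 W ×ˢ Icc 1 W | (x.1 : ZMod p) = lam * x.2 ∧ x.1.Coprime x.2 ∧ x.1 ≤ x.2} ≤
      W ^ 2 / p + 1 := by
  have hp : 0 < p := (Fact.out : p.Prime).pos
  -- A larger fraction exceeds a smaller one by `p / (b b')` at least, hence the integer parts of
  -- their multiples by `W ^ 2 / p` differ.
  have hsep : ∀ a b a' b' : ℕ, 1 ≤ b → b ≤ W → 1 ≤ b' → b' ≤ W → (a : ZMod p) = lam * b →
      (a' : ZMod p) = lam * b' → a * b' < a' * b →
      a * W ^ 2 / (b * p) < a' * W ^ 2 / (b' * p) := by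
    intro a b a' b' hb hbW hb' hbW' h h' hlt
    have hdvd : p ∣ a' * b - a * b' := by
      rw [← ZMod.natCast_eq_zero_iff, Nat.cast_sub hlt.le]
      push_cast
      rw [h, h']
      ring
    have hge : a * b' + p ≤ a' * b := by
      have := Nat.le_of_dvd (by omega) hdvd
      omega
    rw [← Nat.succ_le_iff, Nat.le_div_iff_mul_le (by positivity)]
    set q := a * W ^ 2 / (b * p) with hq
    have hqm : q * (b * p) ≤ a * W ^ 2 := Nat.div_mul_le_self _ _
    refine Nat.le_of_mul_le_mul_left (c := b) ?_ hb
    calc b * (q.succ * (b' * p)) = q * (b * p) * b' + b * b' * p := by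
          rw [Nat.succ_eq_add_one]; ring
      _ ≤ a * W ^ 2 * b' + W * W * p := by gcongr
      _ = (a * b' + p) * W ^ 2 := by ring
      _ ≤ a' * b * W ^ 2 := by gcongr
      _ = b * (a' * W ^ 2) := by ring
  rw [← card_range (W ^ 2 / p + 1)]
  refine card_le_card_of_injOn (fun x => x.1 * W ^ 2 / (x.2 * p)) ?_ ?_
  · rintro ⟨a, b⟩ h
    simp only [coe_filter, mem_product, mem_Icc, Set.mem_ofPred_eq, coe_range, Set.mem_Iio] at h ⊢
    rw [Nat.lt_succ_iff, ← Nat.div_div_eq_div_mul]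
    apply Nat.div_le_div_right
    apply Nat.div_le_of_le_mul
    gcongr
    exact h.2.2.2
  · rintro ⟨a, b⟩ h ⟨a', b'⟩ h' he
    simp only [coe_filter, mem_product, mem_Icc, Set.mem_ofPred_eq] at h h' he
    rcases lt_trichotomy (a * b') (a' * b) with hlt | heq | hgt
    · exact absurd he (hsep a b a' b' (by omega) (by omega) (by omega) (by omega) h.2.1 h'.2.1
        hlt).ne
    · have h1 : a ∣ a' := h.2.2.1.dvd_of_dvd_mul_right ⟨b', heq.symm⟩
      have h2 : a' ∣ a := h'.2.2.1.dvd_of_dvd_mul_right ⟨b, heq⟩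
      obtain rfl := Nat.dvd_antisymm h1 h2
      rw [Prod.mk.injEq]
      exact ⟨rfl, (Nat.eq_of_mul_eq_mul_left (by omega) heq).symm⟩
    · exact absurd he (hsep a' b' a b (by omega) (by omega) (by omega) (by omega) h'.2.1 h.2.1
        hgt).ne'

lemma coprimePowCount_le [Fact p.Prime] (ht : 0 < t) {W : ℕ} (hW : W < p) :
    coprimePowCount p t W ≤ 2 * (W ^ 2 / p + 1) * t := by
  refine (card_le_mul_card_image_of_maps_to (f := fun x : ℕ × ℕ => (x.1 : ZMod p) / x.2)
    (t := unityRoots (ZMod p) t) ?_ (2 * (W ^ 2 / p + 1)) ?_).trans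
    (Nat.mul_le_mul_left _ (card_pow_eq_le ht (1 : ZMod p)))
  · rintro ⟨a, b⟩ h
    simp only [mem_filter, mem_product] at h
    have hb := natCast_ne_zero_of_mem_Icc h.1.2 hW
    rw [mem_unityRoots, div_pow, h.2.1, div_self (pow_ne_zero _ hb)]
  · intro lam _
    set S := {x ∈ Icc 1 W ×ˢ Icc 1 W | (x.1 : ZMod p) = lam * x.2 ∧ x.1.Coprime x.2 ∧ x.1 ≤ x.2}
    set S' := {x ∈ Icc 1 W ×ˢ Icc 1 W |
      (x.1 : ZMod p) = lam⁻¹ * x.2 ∧ x.1.Coprime x.2 ∧ x.1 ≤ x.2} with hS'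
    have hsub : {x ∈ {x ∈ Icc 1 W ×ˢ Icc 1 W | (x.1 : ZMod p) ^ t = (x.2 : ZMod p) ^ t ∧
        x.1.Coprime x.2} | (x.1 : ZMod p) / x.2 = lam} ⊆ S ∪ S'.image Prod.swap := by
      rintro ⟨a, b⟩ h
      simp only [mem_filter, mem_product] at h
      have ha := natCast_ne_zero_of_mem_Icc h.1.1.1 hW
      have hb := natCast_ne_zero_of_mem_Icc h.1.1.2 hW
      have hl := h.2
      rw [div_eq_iff hb] at hl
      rw [mem_union]
      rcases le_total a b with hab | hab
      · exact Or.inl (mem_filter.2 ⟨mem_product.2 h.1.1, hl, h.1.2.2, hab⟩)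
      · refine Or.inr (mem_image.2 ⟨(b, a), mem_filter.2 ⟨mem_product.2 h.1.1.symm, ?_,
          h.1.2.2.symm, hab⟩, rfl⟩)
        simp only
        rw [← h.2]
        field_simp
    have h1 : #S ≤ W ^ 2 / p + 1 := card_coprime_fractions_le lam
    have h2 : #S' ≤ W ^ 2 / p + 1 := card_coprime_fractions_le lam⁻¹
    have h3 := card_union_le S (S'.image Prod.swap)
    have h4 : #(S'.image Prod.swap) ≤ #S' := card_image_le
    have h5 := card_le_card hsub
    omega

lemma coprimePowCount_le_real [Fact p.Prime] (ht : 0 < t) {W : ℕ} (hW : W < p) :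
    (coprimePowCount p t W : ℝ) ≤ 2 * t * ((W : ℝ) ^ 2 / p + 1) := by
  have h1 : (coprimePowCount p t W : ℝ) ≤ 2 * (((W ^ 2 / p : ℕ) : ℝ) + 1) * t := by
    exact_mod_cast coprimePowCount_le ht hW
  have h2 : ((W ^ 2 / p : ℕ) : ℝ) ≤ (W : ℝ) ^ 2 / p := by
    exact_mod_cast Nat.cast_div_le (α := ℝ) (m := W ^ 2) (n := p)
  calc _ ≤ _ := h1
    _ ≤ 2 * ((W : ℝ) ^ 2 / p + 1) * t := by gcongr
    _ = _ := by ring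

lemma powCount_le_of_linear [Fact p.Prime] {R : ℕ} (hR : R < p) {K L : ℝ} (hK : 0 ≤ K)
    (hL : 1 + Real.log p ≤ L) (hlin : ∀ W ≤ R, (coprimePowCount p t W : ℝ) ≤ K * W) :
    (powCount p t R : ℝ) ≤ K * R * L := by
  have h1 : (powCount p t R : ℝ) ≤ ∑ d ∈ Icc 1 R, (coprimePowCount p t (R / d) : ℝ) := by
    exact_mod_cast powCount_le_sum hR
  have h2 : ((harmonic R : ℚ) : ℝ) ≤ L := by
    refine (harmonic_le_one_add_log R).trans (le_trans ?_ hL)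
    rcases Nat.eq_zero_or_pos R with rfl | h0
    · have : 0 ≤ Real.log p := Real.log_natCast_nonneg p
      simpa using this
    · gcongr
  refine h1.trans (le_trans ?_ (mul_le_mul_of_nonneg_left h2 (by positivity)))
  rw [harmonic_eq_sum_Icc]
  push_cast
  rw [mul_sum]
  refine sum_le_sum fun d _ => (hlin _ (Nat.div_le_self _ _)).trans ?_
  rw [mul_assoc]
  gcongr
  rw [← div_eq_mul_inv]
  exact Nat.cast_div_le

/-- A parameter `L` that dominates the divisor function and the logarithm up to `p`. -/
structure DominatesDivisors (p L : ℕ) : Prop where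
  card_divisors_le : ∀ n, n ≠ 0 → n ≤ p → #n.divisors ≤ L
  one_add_log_le : 1 + Real.log p ≤ L

variable {L : ℕ} {q : ℝ}

lemma DominatesDivisors.one_le (hL : DominatesDivisors p L) : (1 : ℝ) ≤ L :=
  le_trans (by linarith [Real.log_natCast_nonneg p]) hL.one_add_log_le

/-- A first bound for `powCount`, from counting fractions in residue classes. Here and below
`q = p ^ (1 / 8)`. -/
lemma powCount_le_first [Fact p.Prime] (hq : 1 < q) (hqp : q ^ 8 = p) (ht : q ^ 4 ≤ t)
    (hL : DominatesDivisors p L) {R : ℕ} (hR : (R : ℝ) ≤ q ^ 6) :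
    (powCount p t R : ℝ) ≤ 4 * t / q ^ 2 * R * L := by
  have hq0 : 0 < q := by linarith
  have ht0 : 0 < t := by
    have : (0 : ℝ) < t := lt_of_lt_of_le (by positivity) ht
    exact_mod_cast this
  have hlt : (R : ℝ) < p := by
    rw [← hqp]
    exact hR.trans_lt (pow_lt_pow_right₀ hq (by norm_num))
  refine powCount_le_of_linear (by exact_mod_cast hlt) (by positivity) hL.one_add_log_le ?_
  intro W hW
  have hWR : (W : ℝ) ≤ R := by exact_mod_cast hW
  have hWp : W < p := by exact_mod_cast hWR.trans_lt hlt
  rcases le_total (W : ℝ) (q ^ 2) with h | h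
  · have h1 : (coprimePowCount p t W : ℝ) ≤ (W : ℝ) ^ 2 := by
      exact_mod_cast (coprimePowCount_le_powCount W).trans (powCount_le_sq W)
    refine h1.trans ?_
    rw [div_mul_eq_mul_div, le_div_iff₀ (by positivity)]
    calc (W : ℝ) ^ 2 * q ^ 2 = W * (W * q ^ 2) := by ring
      _ ≤ W * (q ^ 2 * q ^ 2) := by gcongr
      _ = W * q ^ 4 := by ring
      _ ≤ W * t := by gcongr
      _ ≤ 4 * t * W := by nlinarith [show (0 : ℝ) ≤ W * t by positivity]
  · refine (coprimePowCount_le_real ht0 hWp).trans ?_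
    have h1 : (W : ℝ) ^ 2 / p ≤ W / q ^ 2 := by
      rw [← hqp, div_le_div_iff₀ (by positivity) (by positivity)]
      calc (W : ℝ) ^ 2 * q ^ 2 = W * q ^ 2 * W := by ring
        _ ≤ W * q ^ 2 * q ^ 6 := by gcongr; exact hWR.trans hR
        _ = W * q ^ 8 := by ring
    have h2 : 1 ≤ (W : ℝ) / q ^ 2 := by rwa [one_le_div (by positivity)]
    calc 2 * (t : ℝ) * ((W : ℝ) ^ 2 / p + 1) ≤ 2 * t * (W / q ^ 2 + W / q ^ 2) := by gcongr
      _ = 4 * t / q ^ 2 * W := by ring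

/-- An improvement of `powCount_le_first` that comes from squaring: for `W ≤ p ^ (3 / 8)` the square
of `powCount p t W` is essentially at most `powCount p t (W ^ 2)`. -/
lemma powCount_le_second [Fact p.Prime] (hq : 1 < q) (hqp : q ^ 8 = p) (ht : q ^ 4 ≤ t)
    (hL : DominatesDivisors p L) {R : ℕ} (hR : (R : ℝ) ≤ q ^ 5) :
    (powCount p t R : ℝ) ≤ 4 * L ^ 2 * t / q ^ 3 * R * L := by
  have hq0 : 0 < q := by linarith
  have hL1 := hL.one_le
  have ht0 : 0 < t := by
    have : (0 : ℝ) < t := lt_of_lt_of_le (by positivity) ht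
    exact_mod_cast this
  have hlt : (R : ℝ) < p := by
    rw [← hqp]
    exact hR.trans_lt (pow_lt_pow_right₀ hq (by norm_num))
  refine powCount_le_of_linear (by exact_mod_cast hlt) (by positivity) hL.one_add_log_le ?_
  intro W hW
  have hWR : (W : ℝ) ≤ R := by exact_mod_cast hW
  have hWp : W < p := by exact_mod_cast hWR.trans_lt hlt
  rcases le_total (W : ℝ) (q ^ 3) with h | h
  · have hWW : ((W * W : ℕ) : ℝ) ≤ q ^ 6 := by
      push_cast
      calc (W : ℝ) * W ≤ q ^ 3 * q ^ 3 := by gcongr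
        _ = q ^ 6 := by ring
    have hWWp : W * W ≤ p := by
      have : ((W * W : ℕ) : ℝ) ≤ p :=
        hWW.trans (hqp ▸ pow_le_pow_right₀ hq.le (by norm_num))
      exact_mod_cast this
    have h1 := powCount_mul_powCount_le (p := p) (t := t) (D := L) (Y := W) (Z := W)
      fun n hn hnW => hL.card_divisors_le n hn (hnW.trans hWWp)
    have h2 : (powCount p t W : ℝ) * powCount p t W ≤ L ^ 2 * powCount p t (W * W) := by
      exact_mod_cast h1
    have h3 := powCount_le_first hq hqp ht hL hWW
    push_cast at h3
    have h4 : (coprimePowCount p t W : ℝ) ≤ powCount p t W := by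
      exact_mod_cast coprimePowCount_le_powCount W
    refine h4.trans (le_of_pow_le_pow_left₀ two_ne_zero (by positivity) ?_)
    calc (powCount p t W : ℝ) ^ 2 = powCount p t W * powCount p t W := sq _
      _ ≤ L ^ 2 * (4 * t / q ^ 2 * (W * W) * L) := h2.trans (by gcongr)
      _ = 4 * L ^ 3 * t * (W ^ 2 / q ^ 6) * q ^ 4 := by field_simp
      _ ≤ 4 * L ^ 3 * t * (W ^ 2 / q ^ 6) * t := by gcongr
      _ ≤ 16 * L ^ 4 * t * (W ^ 2 / q ^ 6) * t := by
          gcongr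
          · norm_num
          · norm_num
      _ = (4 * L ^ 2 * t / q ^ 3 * W) ^ 2 := by field_simp; ring
  · refine (coprimePowCount_le_real ht0 hWp).trans ?_
    have h1 : (W : ℝ) ^ 2 / p ≤ W / q ^ 3 := by
      rw [← hqp, div_le_div_iff₀ (by positivity) (by positivity)]
      calc (W : ℝ) ^ 2 * q ^ 3 = W * q ^ 3 * W := by ring
        _ ≤ W * q ^ 3 * q ^ 5 := by gcongr; exact hWR.trans hR
        _ = W * q ^ 8 := by ring
    have h2 : 1 ≤ (W : ℝ) / q ^ 3 := by rwa [one_le_div (by positivity)]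
    calc 2 * (t : ℝ) * ((W : ℝ) ^ 2 / p + 1) ≤ 2 * t * (W / q ^ 3 + W / q ^ 3) := by gcongr
      _ = 4 * 1 ^ 2 * t / q ^ 3 * W := by ring
      _ ≤ 4 * L ^ 2 * t / q ^ 3 * W := by gcongr

/-- The bound for `powCount` at the length `Z ≤ p ^ (5 / 24)`, from `powCount_le_second` at the
length `Z ^ 3`. -/
theorem powCount_cube_le [Fact p.Prime] (hq : 1 < q) (hqp : q ^ 8 = p) (ht : q ^ 4 ≤ t)
    (hL : DominatesDivisors p L) {Z : ℕ} (hZ : (Z : ℝ) ^ 3 ≤ q ^ 5) :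
    (powCount p t Z : ℝ) ^ 3 ≤ 4 * L ^ 7 * t * Z ^ 3 / q ^ 3 := by
  have hq0 : 0 < q := by linarith
  rcases Nat.eq_zero_or_pos Z with rfl | hZ0
  · simp [powCount]
  have hZp : Z * Z * Z ≤ p := by
    have : ((Z * Z * Z : ℕ) : ℝ) ≤ p := by
      push_cast
      calc (Z : ℝ) * Z * Z = Z ^ 3 := by ring
        _ ≤ q ^ 8 := hZ.trans (pow_le_pow_right₀ hq.le (by norm_num))
        _ = p := hqp
    exact_mod_cast this
  have hZp' : Z * Z ≤ p := (Nat.le_mul_of_pos_right _ hZ0).trans hZp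
  have h1 := powCount_mul_powCount_le (p := p) (t := t) (D := L) (Y := Z) (Z := Z)
    fun n hn h => hL.card_divisors_le n hn (h.trans hZp')
  have h2 := powCount_mul_powCount_le (p := p) (t := t) (D := L) (Y := Z * Z) (Z := Z)
    fun n hn h => hL.card_divisors_le n hn (h.trans hZp)
  have h3 : powCount p t Z ^ 3 ≤ L ^ 4 * powCount p t (Z * Z * Z) := by
    calc powCount p t Z ^ 3 = powCount p t Z * powCount p t Z * powCount p t Z := by ring
      _ ≤ L ^ 2 * powCount p t (Z * Z) * powCount p t Z := by gcongr
      _ = L ^ 2 * (powCount p t (Z * Z) * powCount p t Z) := by ring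
      _ ≤ L ^ 2 * (L ^ 2 * powCount p t (Z * Z * Z)) := by gcongr
      _ = _ := by ring
  have h4 : (powCount p t Z : ℝ) ^ 3 ≤ L ^ 4 * powCount p t (Z * Z * Z) := by exact_mod_cast h3
  have h5 := powCount_le_second hq hqp ht hL (R := Z * Z * Z)
    (by push_cast; calc (Z : ℝ) * Z * Z = Z ^ 3 := by ring
          _ ≤ _ := hZ)
  calc (powCount p t Z : ℝ) ^ 3 ≤ L ^ 4 * (4 * L ^ 2 * t / q ^ 3 * ((Z * Z * Z : ℕ) : ℝ) * L) :=
        h4.trans (by gcongr)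
    _ = 4 * L ^ 7 * t * Z ^ 3 / q ^ 3 := by push_cast; ring

end PowCount

/-! ### Exponential sums -/

section Fourier

variable {p : ℕ} [Fact p.Prime]

lemma sum_stdAddChar_mul (b : ZMod p) :
    ∑ a : ZMod p, ZMod.stdAddChar (a * b) = if b = 0 then (p : ℂ) else 0 := by
  rw [AddChar.sum_mulShift b (ZMod.isPrimitive_stdAddChar p), ZMod.card]
  split_ifs <;> simp

lemma conj_stdAddChar (a : ZMod p) :
    (starRingEnd ℂ) (ZMod.stdAddChar a) = ZMod.stdAddChar (-a) :=
  (AddChar.map_neg_eq_conj _ _).symm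

/-- Parseval's identity. -/
lemma sum_norm_sq_fourier (w : ZMod p → ℂ) :
    ∑ a : ZMod p, ‖∑ x, w x * ZMod.stdAddChar (a * x)‖ ^ 2 = p * ∑ x, ‖w x‖ ^ 2 := by
  rw [← Complex.ofReal_inj]
  push_cast
  have h1 : ∀ a : ZMod p, ((‖∑ x, w x * ZMod.stdAddChar (a * x)‖ : ℝ) : ℂ) ^ 2 =
      ∑ x, ∑ y, w x * (starRingEnd ℂ) (w y) * ZMod.stdAddChar (a * (x - y)) := by
    intro a
    rw [← Complex.mul_conj', map_sum, sum_mul_sum]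
    refine sum_congr rfl fun x _ => sum_congr rfl fun y _ => ?_
    rw [map_mul (starRingEnd ℂ), conj_stdAddChar, mul_sub, sub_eq_add_neg, AddChar.map_add_eq_mul]
    ring
  simp_rw [h1]
  rw [sum_comm, mul_sum]
  refine sum_congr rfl fun x _ => ?_
  rw [sum_comm]
  simp_rw [← mul_sum, sum_stdAddChar_mul, sub_eq_zero]
  simp only [mul_ite, mul_zero, sum_ite_eq, mem_univ, if_true]
  rw [Complex.mul_conj', mul_comm]

/-- The exponential sum over a set of residues. -/
noncomputable def residueSum (S : Finset (ZMod p)) (a : ZMod p) : ℂ :=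
  ∑ x ∈ S, ZMod.stdAddChar (a * x)

/-- The exponential sum over the interval `[0, K)`. -/
noncomputable def intervalSum (K : ℕ) (a : ZMod p) : ℂ :=
  ∑ n ∈ range K, ZMod.stdAddChar a ^ n

lemma sum_norm_sq_residueSum (S : Finset (ZMod p)) :
    ∑ a, ‖residueSum S a‖ ^ 2 = p * #S := by
  have h := sum_norm_sq_fourier (fun x : ZMod p => if x ∈ S then (1 : ℂ) else 0)
  have h1 : ∀ x : ZMod p, ‖(if x ∈ S then (1 : ℂ) else 0)‖ ^ 2 = if x ∈ S then (1 : ℝ) else 0 := by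
    intro x; split_ifs <;> simp
  simp only [h1, ite_mul, one_mul, zero_mul, sum_ite_mem, univ_inter, sum_const, nsmul_eq_mul,
    mul_one] at h
  exact h

lemma residueSum_neg (S : Finset (ZMod p)) (a : ZMod p) :
    residueSum S (-a) = (starRingEnd ℂ) (residueSum S a) := by
  rw [residueSum, residueSum, map_sum]
  exact sum_congr rfl fun x _ => by rw [conj_stdAddChar, neg_mul]

lemma norm_intervalSum_le (K : ℕ) (a : ZMod p) : ‖intervalSum K a‖ ≤ K := by
  refine (norm_sum_le _ _).trans ?_
  simp

/-- The bound of a geometric sum by the distance of its ratio from `1`. -/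
lemma norm_intervalSum_le_div (K : ℕ) {a : ZMod p} (ha : a ≠ 0) :
    ‖intervalSum K a‖ ≤ p / (2 * (a.valMinAbs.natAbs : ℝ)) := by
  have hp : (0 : ℝ) < p := by exact_mod_cast (Fact.out : p.Prime).pos
  set m := a.valMinAbs with hm
  have hm0 : 0 < (m.natAbs : ℝ) := by
    have : m.natAbs ≠ 0 := by simpa [hm, ZMod.valMinAbs_eq_zero] using ha
    positivity
  have hmle : 2 * (m.natAbs : ℝ) ≤ p := by
    have := ZMod.natAbs_valMinAbs_le a
    have h2 : 2 * m.natAbs ≤ p := by omega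
    exact_mod_cast h2
  have hlow : 4 * (m.natAbs : ℝ) / p ≤ ‖(ZMod.stdAddChar a : ℂ) - 1‖ := by
    have h1 : (ZMod.stdAddChar a : ℂ) =
        Complex.exp (Complex.I * ((2 * Real.pi * m / p : ℝ) : ℂ)) := by
      conv_lhs => rw [← ZMod.coe_valMinAbs a]
      rw [ZMod.stdAddChar_coe, ← hm]
      congr 1
      push_cast
      ring
    have habs : |(m : ℝ)| = m.natAbs := by rw [Nat.cast_natAbs, Int.cast_abs]
    rw [h1, Complex.norm_exp_I_mul_ofReal_sub_one, norm_mul, Real.norm_eq_abs, Real.norm_eq_abs,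
      abs_two]
    have h2 : |Real.sin (2 * Real.pi * m / p / 2)| = |Real.sin (Real.pi * (m.natAbs / p))| := by
      rw [← habs]
      rcases le_total 0 (m : ℝ) with h | h
      · rw [abs_of_nonneg h]; congr 2; ring
      · rw [abs_of_nonpos h, ← abs_neg, ← Real.sin_neg]; congr 2; ring
    have h3 : (m.natAbs : ℝ) / p ≤ 1 / 2 := by
      rw [div_le_div_iff₀ hp two_pos]; linarith
    have h4 := Real.mul_le_sin (x := Real.pi * (m.natAbs / p)) (by positivity)
      (by nlinarith [Real.pi_pos])
    have h5 : 2 / Real.pi * (Real.pi * ((m.natAbs : ℝ) / p)) = 2 * (m.natAbs / p) := by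
      field_simp
    rw [h2]
    have h6 := le_abs_self (Real.sin (Real.pi * ((m.natAbs : ℝ) / p)))
    rw [mul_div_assoc]
    linarith
  have hgeom : ‖intervalSum K a‖ * ‖(ZMod.stdAddChar a : ℂ) - 1‖ ≤ 2 := by
    rw [← norm_mul, intervalSum, geom_sum_mul]
    refine (norm_sub_le _ _).trans ?_
    simp
    norm_num
  rw [le_div_iff₀ (by positivity)]
  have h7 : ‖intervalSum K a‖ * (4 * (m.natAbs : ℝ) / p) ≤ 2 :=
    (mul_le_mul_of_nonneg_left hlow (norm_nonneg _)).trans hgeom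
  rw [← mul_div_assoc, div_le_iff₀ hp] at h7
  linarith

/-- If no element of `V` lies in a translate of `U` by the sums of `k` elements of `[0, K)`, then
the Fourier coefficients of `U`, `V` and the interval cancel. -/
lemma sum_residueSum_eq_zero {U V : Finset (ZMod p)} {k K : ℕ}
    (h : ∀ u ∈ U, ∀ v ∈ V, ∀ n ≤ k * (K - 1), v ≠ u + (n : ZMod p)) :
    ∑ a, residueSum U a * (starRingEnd ℂ) (residueSum V a) * intervalSum K a ^ k = 0 := by
  set Q : Polynomial ℂ := (∑ n ∈ range K, Polynomial.X ^ n) ^ k with hQ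
  have hdeg : Q.natDegree < k * (K - 1) + 1 := by
    rw [Nat.lt_succ_iff]
    refine Polynomial.natDegree_pow_le.trans (Nat.mul_le_mul_left _ ?_)
    refine Polynomial.natDegree_sum_le_of_forall_le _ _ fun n hn => ?_
    rw [Polynomial.natDegree_X_pow]
    have := mem_range.1 hn
    omega
  have hI : ∀ a : ZMod p, intervalSum K a ^ k =
      ∑ n ∈ range (k * (K - 1) + 1), Q.coeff n * ZMod.stdAddChar (a * (n : ZMod p)) := by
    intro a
    have h1 : intervalSum K a ^ k = Q.eval (ZMod.stdAddChar a) := by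
      simp [hQ, intervalSum, Polynomial.eval_finsetSum]
    rw [h1, Polynomial.eval_eq_sum_range' hdeg]
    refine sum_congr rfl fun n _ => ?_
    rw [← AddChar.map_nsmul_eq_pow, nsmul_eq_mul, mul_comm a]
  have hexp : ∀ a : ZMod p,
      residueSum U a * (starRingEnd ℂ) (residueSum V a) * intervalSum K a ^ k =
      ∑ u ∈ U, ∑ v ∈ V, ∑ n ∈ range (k * (K - 1) + 1),
        Q.coeff n * ZMod.stdAddChar (a * (u + (n : ZMod p) - v)) := by
    intro a
    rw [hI, residueSum, residueSum, map_sum, sum_mul_sum, sum_mul]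
    refine sum_congr rfl fun u _ => ?_
    rw [sum_mul]
    refine sum_congr rfl fun v _ => ?_
    rw [mul_sum]
    refine sum_congr rfl fun n _ => ?_
    have h1 : a * (u + (n : ZMod p) - v) = a * u + a * (n : ZMod p) + -(a * v) := by ring
    rw [h1, AddChar.map_add_eq_mul, AddChar.map_add_eq_mul, conj_stdAddChar]
    ring
  simp_rw [hexp]
  rw [sum_comm]
  refine sum_eq_zero fun u hu => ?_
  rw [sum_comm]
  refine sum_eq_zero fun v hv => ?_
  rw [sum_comm]
  refine sum_eq_zero fun n hn => ?_
  rw [← mul_sum, sum_stdAddChar_mul, if_neg, mul_zero]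
  rw [sub_eq_zero]
  exact fun h0 => h u hu v hv n (Nat.lt_succ_iff.1 (mem_range.1 hn)) h0.symm

/-- The variance bound for the set of `u` whose translates of an interval avoid `V`. -/
lemma card_avoiding_le {U V : Finset (ZMod p)} {k K : ℕ}
    (h : ∀ u ∈ U, ∀ v ∈ V, ∀ n ≤ k * (K - 1), v ≠ u + (n : ZMod p)) :
    (#U : ℝ) * #V ^ 2 * K ^ (2 * k) ≤
      p * ∑ a ∈ univ.erase (0 : ZMod p), ‖residueSum V a‖ ^ 2 * ‖intervalSum K a‖ ^ (2 * k) := by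
  have h0 := sum_residueSum_eq_zero h
  rw [← add_sum_erase _ _ (mem_univ (0 : ZMod p)), add_eq_zero_iff_eq_neg] at h0
  have hz : residueSum U 0 * (starRingEnd ℂ) (residueSum V 0) * intervalSum K (0 : ZMod p) ^ k =
      (#U : ℂ) * #V * (K : ℂ) ^ k := by
    simp [residueSum, intervalSum]
  rw [hz] at h0
  have h1 : (#U : ℝ) * #V * K ^ k ≤ ∑ a ∈ univ.erase (0 : ZMod p),
      ‖residueSum U a‖ * (‖residueSum V a‖ * ‖intervalSum K a‖ ^ k) := by
    have h2 := congrArg norm h0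
    rw [norm_neg] at h2
    simp only [norm_mul, norm_pow, Complex.norm_natCast] at h2
    rw [h2]
    refine (norm_sum_le _ _).trans (le_of_eq (sum_congr rfl fun a _ => ?_))
    simp only [norm_mul, norm_pow, RCLike.norm_conj]
    ring
  set E := ∑ a ∈ univ.erase (0 : ZMod p), ‖residueSum V a‖ ^ 2 * ‖intervalSum K a‖ ^ (2 * k)
    with hE
  have h3 : ((#U : ℝ) * #V * K ^ k) ^ 2 ≤ (p * #U) * E := by
    calc ((#U : ℝ) * #V * K ^ k) ^ 2 ≤ (∑ a ∈ univ.erase (0 : ZMod p),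
          ‖residueSum U a‖ * (‖residueSum V a‖ * ‖intervalSum K a‖ ^ k)) ^ 2 := by gcongr
      _ ≤ (∑ a ∈ univ.erase (0 : ZMod p), ‖residueSum U a‖ ^ 2) *
          ∑ a ∈ univ.erase (0 : ZMod p), (‖residueSum V a‖ * ‖intervalSum K a‖ ^ k) ^ 2 :=
          sum_mul_sq_le_sq_mul_sq _ _ _
      _ ≤ (p * #U) * E := by
          rw [← sum_norm_sq_residueSum U]
          have he : E = ∑ a ∈ univ.erase (0 : ZMod p),
              (‖residueSum V a‖ * ‖intervalSum K a‖ ^ k) ^ 2 :=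
            sum_congr rfl fun a _ => by rw [mul_pow, ← pow_mul, mul_comm k 2]
          rw [he]
          gcongr
          exact subset_univ _
  rcases Nat.eq_zero_or_pos #U with hU | hU
  · rw [hU]
    simp only [Nat.cast_zero, zero_mul]
    positivity
  · have hU' : (0 : ℝ) < #U := by exact_mod_cast hU
    refine le_of_mul_le_mul_left ?_ hU'
    calc (#U : ℝ) * (#U * #V ^ 2 * K ^ (2 * k)) = ((#U : ℝ) * #V * K ^ k) ^ 2 := by
          rw [mul_pow, mul_pow, ← pow_mul, mul_comm k 2]; ring
      _ ≤ (p * #U) * E := h3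
      _ = #U * (p * E) := by ring

lemma sum_short_le (V : Finset (ZMod p)) (Z : ℕ) :
    ∑ a ∈ univ.erase (0 : ZMod p) with a.valMinAbs.natAbs ≤ Z, ‖residueSum V a‖ ^ 2 ≤
      2 * ∑ n ∈ Icc 1 Z, ‖residueSum V (n : ZMod p)‖ ^ 2 := by
  rw [← sum_fiberwise_of_maps_to (t := Icc 1 Z) (g := fun a : ZMod p => a.valMinAbs.natAbs),
    mul_sum]
  · refine sum_le_sum fun n _ => ?_
    have hcases : ∀ a : ZMod p, a.valMinAbs.natAbs = n → a = n ∨ a = -n := by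
      rintro a rfl
      rcases Int.natAbs_eq a.valMinAbs with h | h
      · left
        conv_lhs => rw [← ZMod.coe_valMinAbs a, h]
        simp
      · right
        conv_lhs => rw [← ZMod.coe_valMinAbs a, h]
        simp
    refine (sum_le_card_nsmul _ _ (‖residueSum V (n : ZMod p)‖ ^ 2) ?_).trans ?_
    · intro a ha
      rcases hcases a (mem_filter.1 ha).2 with rfl | rfl
      · rfl
      · rw [residueSum_neg, RCLike.norm_conj]
    · rw [nsmul_eq_mul]
      gcongr
      have : #{a ∈ {a ∈ univ.erase (0 : ZMod p) | a.valMinAbs.natAbs ≤ Z} |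
          a.valMinAbs.natAbs = n} ≤ #{(n : ZMod p), -(n : ZMod p)} := by
        refine card_le_card fun a ha => ?_
        simpa using hcases a (mem_filter.1 ha).2
      exact_mod_cast this.trans card_le_two
  · intro a ha
    rw [mem_filter, mem_erase] at ha
    rw [mem_Icc]
    refine ⟨?_, ha.2⟩
    have : a.valMinAbs.natAbs ≠ 0 := by simpa [ZMod.valMinAbs_eq_zero] using ha.1.1
    omega

/-- Only the frequencies up to `Z` matter once `Z` exceeds `p / K` by a power of `p`. -/
lemma card_avoiding_le_short {U V : Finset (ZMod p)} {k K Z : ℕ} (hZ : 0 < Z)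
    (h : ∀ u ∈ U, ∀ v ∈ V, ∀ n ≤ k * (K - 1), v ≠ u + (n : ZMod p)) :
    (#U : ℝ) * #V ^ 2 * K ^ (2 * k) ≤
      p * (K ^ (2 * k) * (2 * ∑ n ∈ Icc 1 Z, ‖residueSum V (n : ZMod p)‖ ^ 2) +
        (p / (2 * Z)) ^ (2 * k) * (p * #V)) := by
  refine (card_avoiding_le h).trans ?_
  gcongr
  rw [← sum_filter_add_sum_filter_not _ (fun a : ZMod p => a.valMinAbs.natAbs ≤ Z)]
  refine add_le_add ?_ ?_
  · refine le_trans ?_ (mul_le_mul_of_nonneg_left (sum_short_le V Z) (by positivity))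
    rw [mul_sum]
    refine sum_le_sum fun a _ => ?_
    rw [mul_comm]
    gcongr
    exact norm_intervalSum_le K a
  · rw [← sum_norm_sq_residueSum V, mul_sum]
    refine (sum_le_sum (g := fun a => (p / (2 * (Z : ℝ))) ^ (2 * k) * ‖residueSum V a‖ ^ 2)
      fun a ha => ?_).trans (sum_le_sum_of_subset_of_nonneg (subset_univ _)
        fun _ _ _ => by positivity)
    rw [mem_filter, mem_erase] at ha
    rw [mul_comm]
    gcongr
    refine (norm_intervalSum_le_div K ha.1.1).trans ?_
    gcongr
    exact (not_le.1 ha.2).le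

variable {t : ℕ}

lemma residueSum_unityRoots_eq (ht : 0 < t) {a b : ZMod p} (hb : b ≠ 0) (hab : a ^ t = b ^ t) :
    residueSum (unityRoots (ZMod p) t) a = residueSum (unityRoots (ZMod p) t) b := by
  have hg : (a / b) ^ t = 1 := by rw [div_pow, hab, div_self (pow_ne_zero _ hb)]
  have hg0 : a / b ≠ 0 := by
    intro h
    rw [h, zero_pow ht.ne'] at hg
    exact zero_ne_one hg
  refine sum_bij (fun x _ => a / b * x) ?_ ?_ ?_ ?_
  · intro x hx
    rw [mem_unityRoots] at hx ⊢
    rw [mul_pow, hg, hx, one_mul]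
  · intro x _ y _ hxy
    exact mul_left_cancel₀ hg0 hxy
  · intro x hx
    rw [mem_unityRoots] at hx
    refine ⟨(a / b)⁻¹ * x, ?_, ?_⟩
    · rw [mem_unityRoots, mul_pow, inv_pow, hg, hx, inv_one, one_mul]
    · rw [mul_inv_cancel_left₀ hg0]
  · intro x _
    congr 1
    field_simp

lemma le_card_pow_eq_pow (hcard : #(unityRoots (ZMod p) t) = t) {b : ZMod p} (hb : b ≠ 0) :
    t ≤ #{y : ZMod p | y ^ t = b ^ t} := by
  conv_lhs => rw [← hcard]
  refine card_le_card_of_injOn (fun x => b * x) ?_ (mul_right_injective₀ hb).injOn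
  intro x hx
  rw [mem_coe, mem_unityRoots] at hx
  simp [mul_pow, hx]

/-- Averaging over a coset of the group of `t`-th roots of unity. -/
lemma card_mul_norm_sq_le (ht : 0 < t) (hcard : #(unityRoots (ZMod p) t) = t) {b : ZMod p}
    (hb : b ≠ 0) :
    t * ‖residueSum (unityRoots (ZMod p) t) b‖ ^ 2 ≤
      ∑ y : ZMod p with y ^ t = b ^ t, ‖residueSum (unityRoots (ZMod p) t) y‖ ^ 2 := by
  rw [sum_congr rfl (g := fun _ => ‖residueSum (unityRoots (ZMod p) t) b‖ ^ 2)
    (fun y hy => by rw [residueSum_unityRoots_eq ht hb (mem_filter.1 hy).2]), sum_const, nsmul_eq_mul]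
  gcongr
  exact le_card_pow_eq_pow hcard hb

lemma norm_sq_residueSum_le (ht : 0 < t) (hcard : #(unityRoots (ZMod p) t) = t) {b : ZMod p}
    (hb : b ≠ 0) : ‖residueSum (unityRoots (ZMod p) t) b‖ ^ 2 ≤ p := by
  have ht' : (0 : ℝ) < t := by exact_mod_cast ht
  refine le_of_mul_le_mul_left ((card_mul_norm_sq_le ht hcard hb).trans ?_) ht'
  calc _ ≤ ∑ y : ZMod p, ‖residueSum (unityRoots (ZMod p) t) y‖ ^ 2 :=
        sum_le_sum_of_subset_of_nonneg (subset_univ _) fun _ _ _ => by positivity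
    _ = t * p := by rw [sum_norm_sq_residueSum, hcard, mul_comm]

/-- The fourth moment of the exponential sums is the additive energy. -/
lemma sum_norm_pow_four :
    ∑ a : ZMod p, ‖residueSum (unityRoots (ZMod p) t) a‖ ^ 4 =
      p * ∑ u : ZMod p, (diffCount t u : ℝ) ^ 2 := by
  have h := sum_norm_sq_fourier (fun u : ZMod p => (diffCount t u : ℂ))
  simp only [Complex.norm_natCast] at h
  rw [← h]
  refine sum_congr rfl fun a _ => ?_
  have h1 : ((‖residueSum (unityRoots (ZMod p) t) a‖ ^ 2 : ℝ) : ℂ) =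
      ∑ u, (diffCount t u : ℂ) * ZMod.stdAddChar (a * u) := by
    push_cast
    rw [← Complex.mul_conj', residueSum, map_sum, sum_mul_sum, ← sum_product',
      ← sum_fiberwise _ (fun x : ZMod p × ZMod p => x.1 - x.2)]
    refine sum_congr rfl fun u _ => ?_
    rw [diffCount, ← nsmul_eq_mul, ← sum_const]
    refine sum_congr rfl fun x hx => ?_
    rw [conj_stdAddChar, ← AddChar.map_add_eq_mul, ← (mem_filter.1 hx).2]
    congr 1
    ring
  rw [← h1, Complex.norm_real, Real.norm_eq_abs, sq_abs]
  ring

/-- The second moment of the exponential sums over short frequencies, bounded by Cauchy–Schwarz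
over the cosets of the group. -/
theorem sq_sum_short_le (ht : 0 < t) (hcard : #(unityRoots (ZMod p) t) = t) {Z : ℕ} (hZ : Z < p) :
    t * (∑ n ∈ Icc 1 Z, ‖residueSum (unityRoots (ZMod p) t) (n : ZMod p)‖ ^ 2) ^ 2 ≤
      p * (∑ u : ZMod p, (diffCount t u : ℝ) ^ 2) * powCount p t Z := by
  set f : ZMod p → ℝ := fun y => ‖residueSum (unityRoots (ZMod p) t) y‖ ^ 2 with hf
  set r : ZMod p → ℕ := fun y => #((Icc 1 Z).filter fun n : ℕ => y ^ t = (n : ZMod p) ^ t) with hr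
  have ht' : (0 : ℝ) < t := by exact_mod_cast ht
  have h1 : t * ∑ n ∈ Icc 1 Z, f n ≤ ∑ y, r y * f y := by
    calc t * ∑ n ∈ Icc 1 Z, f n
        ≤ ∑ n ∈ Icc 1 Z, ∑ y : ZMod p with y ^ t = (n : ZMod p) ^ t, f y := by
          rw [mul_sum]
          exact sum_le_sum fun n hn => card_mul_norm_sq_le ht hcard
            (natCast_ne_zero_of_mem_Icc hn hZ)
      _ = ∑ y, r y * f y := by
          simp_rw [sum_filter]
          rw [sum_comm]
          refine sum_congr rfl fun y _ => ?_
          rw [← sum_filter, sum_const, nsmul_eq_mul]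
  have h2 : ∑ y, (r y : ℝ) ^ 2 ≤ t * powCount p t Z := by
    have h3 : ∑ y, r y ^ 2 ≤ t * powCount p t Z := by
      have h4 : ∀ y, r y ^ 2 = ∑ x ∈ Icc 1 Z ×ˢ Icc 1 Z,
          if y ^ t = (x.1 : ZMod p) ^ t ∧ y ^ t = (x.2 : ZMod p) ^ t then 1 else 0 := by
        intro y
        rw [← card_filter, sq, hr, ← card_product, ← filter_product]
      simp_rw [h4]
      rw [sum_comm, powCount, card_filter, mul_sum]
      refine sum_le_sum fun x _ => ?_
      rw [← card_filter]
      split_ifs with hx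
      · rw [mul_one]
        refine (card_le_card ?_).trans (card_pow_eq_le ht ((x.1 : ZMod p) ^ t))
        intro y hy
        simp only [mem_filter, mem_univ, true_and] at hy ⊢
        exact hy.1
      · rw [mul_zero, Nat.le_zero, card_eq_zero, filter_eq_empty_iff]
        exact fun y _ hy => hx (hy.1.symm.trans hy.2)
    exact_mod_cast h3
  have h5 : ∑ y, f y ^ 2 = p * ∑ u : ZMod p, (diffCount t u : ℝ) ^ 2 := by
    rw [← sum_norm_pow_four]
    exact sum_congr rfl fun y _ => by simp only [hf]; ring
  have h6 : 0 ≤ ∑ n ∈ Icc 1 Z, f n := sum_nonneg fun _ _ => by positivity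
  refine le_of_mul_le_mul_left ?_ ht'
  calc (t : ℝ) * (t * (∑ n ∈ Icc 1 Z, f n) ^ 2) = (t * ∑ n ∈ Icc 1 Z, f n) ^ 2 := by ring
    _ ≤ (∑ y, r y * f y) ^ 2 := by gcongr
    _ ≤ (∑ y, (r y : ℝ) ^ 2) * ∑ y, f y ^ 2 := sum_mul_sq_le_sq_mul_sq _ _ _
    _ ≤ t * powCount p t Z * ∑ y, f y ^ 2 := by
        gcongr
    _ = t * (p * (∑ u : ZMod p, (diffCount t u : ℝ) ^ 2) * powCount p t Z) := by rw [h5]; ring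

end Fourier

/-! ### The avoiding set -/

section Combination

variable {p t L Z : ℕ} [Fact p.Prime] {q : ℝ}

/-- The second moment of the exponential sums over short frequencies is small compared with its
trivial bound `Z t ^ 2`. For `t ≤ p ^ (5 / 8)` this combines the energy and the fraction counts, and
for larger `t` the bound `√p` for a single sum suffices. -/
theorem sum_short_pow_six_le (hq : 2 ^ 16 ≤ q ^ 3) (hq1 : 1 < q) (hqp : q ^ 8 = p)
    (ht : q ^ 4 ≤ t) (ht16 : 16 ≤ t) (hcard : #(unityRoots (ZMod p) t) = t)
    (hL : DominatesDivisors p L) (hZ : (Z : ℝ) ^ 3 ≤ q ^ 5) :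
    (∑ n ∈ Icc 1 Z, ‖residueSum (unityRoots (ZMod p) t) (n : ZMod p)‖ ^ 2) ^ 6 ≤
      4 * 5001 ^ 3 * L ^ 7 * (Z ^ 3 / q ^ 5) * t ^ 12 := by
  have hq0 : 0 < q := by linarith
  have hL1 := hL.one_le
  have ht0 : 0 < t := by omega
  have ht' : (0 : ℝ) < t := by exact_mod_cast ht0
  have hZp : Z < p := by
    have h1 : (Z : ℝ) < q ^ 8 := by
      refine lt_of_pow_lt_pow_left₀ 3 (by positivity) (hZ.trans_lt ?_)
      rw [← pow_mul]
      exact pow_lt_pow_right₀ hq1 (by norm_num)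
    rw [hqp] at h1
    exact_mod_cast h1
  set S := ∑ n ∈ Icc 1 Z, ‖residueSum (unityRoots (ZMod p) t) (n : ZMod p)‖ ^ 2 with hS
  have hS0 : 0 ≤ S := sum_nonneg fun _ _ => by positivity
  rcases le_total (t : ℝ) (q ^ 5) with hle | hge
  · have hp6 : 2 ^ 16 * t ^ 9 ≤ p ^ 6 := by
      have : (2 : ℝ) ^ 16 * t ^ 9 ≤ p ^ 6 := by
        calc (2 : ℝ) ^ 16 * t ^ 9 ≤ q ^ 3 * (q ^ 5) ^ 9 := by gcongr
          _ = (q ^ 8) ^ 6 := by ring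
          _ = p ^ 6 := by rw [hqp]
      exact_mod_cast this
    have hE := sum_sq_diffCount_le (F := ZMod p) (p := p) ht16 hp6
    have hN := powCount_cube_le hq1 hqp ht hL hZ
    have h1 := sq_sum_short_le ht0 hcard hZp
    rw [← hS] at h1
    obtain ⟨s, hs0, hst⟩ : ∃ s : ℝ, 0 ≤ s ∧ s ^ 2 = t :=
      ⟨√t, Real.sqrt_nonneg _, Real.sq_sqrt ht'.le⟩
    have hsqrt : √(t : ℝ) = s := by rw [← hst, Real.sqrt_sq hs0]
    rw [hsqrt] at hE
    have hqs : q ^ 2 ≤ s := by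
      refine le_of_pow_le_pow_left₀ two_ne_zero hs0 ?_
      rw [hst, ← pow_mul]
      exact ht
    have h2 : S ^ 2 ≤ 5001 * p * s ^ 3 * powCount p t Z := by
      refine le_of_mul_le_mul_left ?_ ht'
      calc (t : ℝ) * S ^ 2 ≤ p * (5001 * t ^ 2 * s) * powCount p t Z := h1.trans (by gcongr)
        _ = t * (5001 * p * (t * s) * powCount p t Z) := by ring
        _ = t * (5001 * p * s ^ 3 * powCount p t Z) := by rw [← hst]; ring
    calc S ^ 6 = (S ^ 2) ^ 3 := by ring
      _ ≤ (5001 * p * s ^ 3 * powCount p t Z) ^ 3 := by gcongr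
      _ = 5001 ^ 3 * p ^ 3 * s ^ 9 * (powCount p t Z : ℝ) ^ 3 := by ring
      _ ≤ 5001 ^ 3 * p ^ 3 * s ^ 9 * (4 * L ^ 7 * t * Z ^ 3 / q ^ 3) := by gcongr
      _ = 4 * 5001 ^ 3 * L ^ 7 * (Z ^ 3 / q ^ 5) * (s ^ 11 * (q ^ 2) ^ 13) := by
          rw [← hqp, ← hst]; field_simp
      _ ≤ 4 * 5001 ^ 3 * L ^ 7 * (Z ^ 3 / q ^ 5) * (s ^ 11 * s ^ 13) := by gcongr
      _ = 4 * 5001 ^ 3 * L ^ 7 * (Z ^ 3 / q ^ 5) * t ^ 12 := by rw [← hst]; ring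
  · have h1 : S ≤ Z * q ^ 8 := by
      have h2 := sum_le_card_nsmul (Icc 1 Z)
        (fun n : ℕ => ‖residueSum (unityRoots (ZMod p) t) (n : ZMod p)‖ ^ 2) (p : ℝ)
        fun n hn => norm_sq_residueSum_le ht0 hcard (natCast_ne_zero_of_mem_Icc hn hZp)
      rw [Nat.card_Icc, nsmul_eq_mul, Nat.add_sub_cancel] at h2
      rw [hqp]
      exact h2
    calc S ^ 6 ≤ (Z * q ^ 8) ^ 6 := by gcongr
      _ = (Z : ℝ) ^ 3 * Z ^ 3 * q ^ 48 := by ring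
      _ ≤ (Z : ℝ) ^ 3 * q ^ 5 * q ^ 48 := by gcongr
      _ = Z ^ 3 / q ^ 5 * q ^ 58 := by field_simp
      _ ≤ Z ^ 3 / q ^ 5 * q ^ 60 := by
          gcongr
          · exact hq1.le
          · norm_num
      _ = 1 * 1 ^ 7 * (Z ^ 3 / q ^ 5) * (q ^ 5) ^ 12 := by ring
      _ ≤ 4 * 5001 ^ 3 * L ^ 7 * (Z ^ 3 / q ^ 5) * t ^ 12 := by
          gcongr
          norm_num

/-- The `t`-th roots of unity are the elements of the subgroup of order `t`. -/
lemma unityRoots_eq_image (G : Subgroup (ZMod p)ˣ) [DecidablePred (· ∈ G)] :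
    unityRoots (ZMod p) (Nat.card G) =
      ({g : (ZMod p)ˣ | g ∈ G} : Finset (ZMod p)ˣ).image Units.val := by
  have hcard : #(({g : (ZMod p)ˣ | g ∈ G} : Finset (ZMod p)ˣ).image Units.val) = Nat.card G := by
    rw [card_image_of_injective _ Units.val_injective, Nat.card_eq_fintype_card,
      Fintype.card_subtype]
  refine (eq_of_subset_of_card_le ?_ ?_).symm
  · intro x hx
    obtain ⟨g, hg, rfl⟩ := mem_image.1 hx
    rw [mem_filter] at hg
    have h1 : g ^ Nat.card G = 1 :=
      congrArg Subtype.val (pow_card_eq_one' (x := (⟨g, hg.2⟩ : G)))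
    rw [mem_unityRoots, ← Units.val_pow_eq_pow_val, h1, Units.val_one]
  · rw [hcard]
    exact card_pow_eq_le Nat.card_pos (1 : ZMod p)

lemma card_unityRoots_natCard (G : Subgroup (ZMod p)ˣ) :
    #(unityRoots (ZMod p) (Nat.card G)) = Nat.card G := by
  classical
  rw [unityRoots_eq_image, card_image_of_injective _ Units.val_injective,
    Nat.card_eq_fintype_card, Fintype.card_subtype]

lemma exists_dominatesDivisors {η : ℝ} (hη : 0 < η) :
    ∃ C : ℝ, 0 < C ∧ ∀ p : ℕ, 1 ≤ p → ∃ L : ℕ,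
      DominatesDivisors p L ∧ (L : ℝ) ≤ C * (p : ℝ) ^ η := by
  obtain ⟨C, hC, hCd⟩ := exists_card_divisors_le hη
  refine ⟨C + 1 + 1 / η + 1, by positivity, fun p hp => ?_⟩
  have hp1 : (1 : ℝ) ≤ p := by exact_mod_cast hp
  have hpη : (1 : ℝ) ≤ (p : ℝ) ^ η := Real.one_le_rpow hp1 hη.le
  have hη' : 0 < 1 / η := by positivity
  refine ⟨⌈(C + 1 + 1 / η) * (p : ℝ) ^ η⌉₊, ⟨fun n hn hnp => ?_, ?_⟩, ?_⟩
  · have h1 : (#n.divisors : ℝ) ≤ (C + 1 + 1 / η) * (p : ℝ) ^ η := by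
      refine (hCd n hn).trans ?_
      gcongr
      linarith
    exact_mod_cast h1.trans (Nat.le_ceil _)
  · refine le_trans ?_ (Nat.le_ceil _)
    have := Real.log_le_rpow_div (x := p) (by positivity) hη
    rw [div_eq_mul_one_div] at this
    nlinarith
  · have := (Nat.ceil_lt_add_one (a := (C + 1 + 1 / η) * (p : ℝ) ^ η) (by positivity)).le
    nlinarith

end Combination

open Filter in
theorem corollary5 (ε : ℝ) (hε : 0 < ε) :
    ∀ δ : ℝ, 0 < δ → ∃ P : ℕ, ∀ p : ℕ, p.Prime → P ≤ p →
      ∀ G : Subgroup (ZMod p)ˣ, (p : ℝ) ^ (1 / 2 : ℝ) < (Nat.card G : ℝ) →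
        ∀ H : ℝ, (p : ℝ) ^ (19 / 24 + ε : ℝ) ≤ H →
          ((avoidingSet p G H).ncard : ℝ) ≤ δ * (p : ℝ) := by
  intro δ hδ
  -- Decreasing `ε` keeps the exponent `5 / 24 - e / 2` of the range of frequencies positive.
  obtain ⟨e, he, heε, he'⟩ : ∃ e : ℝ, 0 < e ∧ e ≤ ε ∧ e ≤ 1 / 24 :=
    ⟨min ε (1 / 24), by positivity, min_le_left _ _, min_le_right _ _⟩
  -- Each factor of the interval sum saves `p ^ (-e / 2)` at the frequencies beyond that range, and
  -- `2 k ≥ 2 / e` of them save a factor `p`.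
  obtain ⟨k, hk⟩ := exists_nat_ge (1 / e)
  have hke : 1 ≤ k * e := by rwa [div_le_iff₀ he] at hk
  have hk0 : 0 < k := by
    rcases Nat.eq_zero_or_pos k with rfl | h
    · norm_num at hke
    · exact h
  have hk0' : (0 : ℝ) < k := by exact_mod_cast hk0
  -- The divisor bound enters to the seventh power, with a loss of `p ^ (e / 2)`, which is less than
  -- the saving `p ^ (3 e / 2)` from `Z ^ 3`.
  obtain ⟨C, hC, hCL⟩ := exists_dominatesDivisors (η := e / 14) (by positivity)
  have hdecay : ∀ (c : ℝ) {a b : ℝ}, 0 < a → 0 < b →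
      ∀ᶠ p : ℕ in atTop, c * (p : ℝ) ^ (-a) ≤ b := by
    intro c a b ha hb
    have h1 : Tendsto (fun p : ℕ => c * (p : ℝ) ^ (-a)) atTop (nhds (c * 0)) :=
      ((tendsto_rpow_neg_atTop ha).comp tendsto_natCast_atTop_atTop).const_mul c
    rw [mul_zero] at h1
    exact h1.eventually_le_const hb
  obtain ⟨P, hP⟩ := eventually_atTop.1 ((hdecay (4 * 5001 ^ 3 * C ^ 7) he
    (show 0 < (δ / 4) ^ 6 by positivity)).and ((hdecay ((k : ℝ) ^ (2 * k))
    (show (0 : ℝ) < 1 / 2 by norm_num) (show 0 < δ / 2 by positivity)).and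
    ((hdecay (2 ^ 16) (show (0 : ℝ) < 3 / 8 by norm_num) one_pos).and (eventually_ge_atTop 256))))
  refine ⟨P, fun p hp hPp G hG H hH => ?_⟩
  obtain ⟨hP1, hP2, hP3, hP4⟩ := hP p hPp
  have : Fact p.Prime := ⟨hp⟩
  obtain ⟨L, hL, hLC⟩ := hCL p hp.one_le
  set x : ℝ := (p : ℝ) with hx
  have hx256 : (256 : ℝ) ≤ x := by rw [hx]; exact_mod_cast hP4
  have hx0 : 0 < x := by linarith
  have hx1 : 1 ≤ x := by linarith
  set t := Nat.card G with ht
  have hcard := card_unityRoots_natCard G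
  rw [← ht] at hcard
  set q : ℝ := x ^ (1 / 8 : ℝ) with hq
  have hqpow : ∀ n : ℕ, q ^ n = x ^ (n / 8 : ℝ) := by
    intro n
    rw [hq, ← Real.rpow_mul_natCast hx0.le]
    congr 1
    ring
  have hq0 : 0 < q := by positivity
  have hqp : q ^ 8 = p := by
    rw [hqpow]; norm_num
    exact hx
  have hq1 : 1 < q := Real.one_lt_rpow (by linarith) (by norm_num)
  have hq4 : q ^ 4 ≤ t := by
    rw [hqpow]
    refine le_trans (le_of_eq ?_) hG.le
    norm_num
  have hq3 : 2 ^ 16 ≤ q ^ 3 := by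
    rw [hqpow]
    rw [Real.rpow_neg hx0.le, ← div_eq_mul_inv, div_le_one (by positivity)] at hP3
    exact_mod_cast hP3
  have ht16 : 16 ≤ t := by
    have h1 : (16 : ℝ) < t := by
      refine lt_of_le_of_lt ?_ hG
      rw [← Real.sqrt_eq_rpow]
      exact Real.le_sqrt_of_sq_le (by linarith)
    exact_mod_cast h1.le
  have ht0 : (0 : ℝ) < t := by exact_mod_cast (show 0 < t by omega)
  -- The range of frequencies.
  set z : ℝ := x ^ (5 / 24 - e / 2) with hz
  have hz1 : 1 ≤ z := Real.one_le_rpow hx1 (by linarith)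
  set Z := ⌊z⌋₊ with hZ
  have hZpos : 0 < Z := Nat.floor_pos.2 hz1
  have hZle : (Z : ℝ) ≤ z := Nat.floor_le (by positivity)
  have hZge : z ≤ 2 * Z := by
    have h1 := Nat.lt_floor_add_one z
    have h2 : (1 : ℝ) ≤ Z := by exact_mod_cast hZpos
    rw [← hZ] at h1
    linarith
  have hz3 : z ^ 3 = x ^ (-(3 * e / 2)) * q ^ 5 := by
    rw [hqpow, hz, ← Real.rpow_mul_natCast hx0.le, ← Real.rpow_add hx0]
    congr 1
    push_cast
    ring
  have hZ3 : (Z : ℝ) ^ 3 ≤ x ^ (-(3 * e / 2)) * q ^ 5 := by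
    rw [← hz3]; gcongr
  have hZ3' : (Z : ℝ) ^ 3 ≤ q ^ 5 := by
    refine hZ3.trans (mul_le_of_le_one_left (by positivity) ?_)
    exact Real.rpow_le_one_of_one_le_of_nonpos hx1 (by linarith)
  set S := ∑ n ∈ Icc 1 Z, ‖residueSum (unityRoots (ZMod p) t) (n : ZMod p)‖ ^ 2 with hS
  have hS1 : S ≤ δ / 4 * t ^ 2 := by
    refine le_of_pow_le_pow_left₀ (n := 6) (by norm_num) (by positivity) ?_
    calc S ^ 6 ≤ 4 * 5001 ^ 3 * L ^ 7 * (Z ^ 3 / q ^ 5) * t ^ 12 :=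
          sum_short_pow_six_le hq3 hq1 hqp hq4 ht16 hcard hL hZ3'
      _ ≤ 4 * 5001 ^ 3 * (C * x ^ (e / 14)) ^ 7 * x ^ (-(3 * e / 2)) * t ^ 12 := by
          gcongr
          rwa [div_le_iff₀ (by positivity)]
      _ = 4 * 5001 ^ 3 * C ^ 7 * x ^ (-e) * t ^ 12 := by
          have h1 : (x ^ (e / 14)) ^ 7 * x ^ (-(3 * e / 2)) = x ^ (-e) := by
            rw [← Real.rpow_mul_natCast hx0.le, ← Real.rpow_add hx0]
            congr 1
            push_cast
            ring
          rw [← h1]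
          ring
      _ ≤ (δ / 4) ^ 6 * t ^ 12 := by gcongr
      _ = (δ / 4 * t ^ 2) ^ 6 := by ring
  -- The interval `[0, H)` contains all sums of `k` elements of `[0, K)`.
  set K := ⌈x ^ (19 / 24 + e) / k⌉₊ with hK
  have hKge : x ^ (19 / 24 + e) / k ≤ K := Nat.le_ceil _
  have hKpos : 0 < K := Nat.ceil_pos.2 (by positivity)
  have hKlt : ((k * (K - 1) : ℕ) : ℝ) < H := by
    have h1 := Nat.ceil_lt_add_one (a := x ^ (19 / 24 + e) / k) (by positivity)
    rw [← hK] at h1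
    have h2 : ((K - 1 : ℕ) : ℝ) < x ^ (19 / 24 + e) / k := by
      rw [Nat.cast_sub hKpos]; push_cast; linarith
    rw [lt_div_iff₀ hk0'] at h2
    calc ((k * (K - 1) : ℕ) : ℝ) = (K - 1 : ℕ) * k := by push_cast; ring
      _ < x ^ (19 / 24 + e) := h2
      _ ≤ x ^ (19 / 24 + ε) := Real.rpow_le_rpow_of_exponent_le hx1 (by linarith)
      _ ≤ H := hH
  have hKpos' : (0 : ℝ) < K := by exact_mod_cast hKpos
  have hZpos' : (0 : ℝ) < Z := by exact_mod_cast hZpos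
  have htail : (x / (2 * Z)) ^ (2 * k) * x ≤ δ / 2 * t * K ^ (2 * k) := by
    have h1 : x / (2 * Z) ≤ k * x ^ (-(e / 2)) * K := by
      rw [div_le_iff₀ (by positivity)]
      rw [div_le_iff₀ hk0'] at hKge
      calc x = x ^ (-(e / 2)) * x ^ (19 / 24 + e) * x ^ (5 / 24 - e / 2) := by
            rw [← Real.rpow_add hx0, ← Real.rpow_add hx0]
            conv_lhs => rw [← Real.rpow_one x]
            congr 1
            ring
        _ ≤ x ^ (-(e / 2)) * (K * k) * (2 * Z) := by gcongr
        _ = k * x ^ (-(e / 2)) * K * (2 * Z) := by ring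
    have h2 : (x ^ (-(e / 2))) ^ (2 * k) * x ≤ 1 := by
      rw [← Real.rpow_mul_natCast hx0.le]
      conv_lhs => rw [← Real.rpow_one x]
      rw [← Real.rpow_mul hx0.le, one_mul, ← Real.rpow_add hx0]
      apply Real.rpow_le_one_of_one_le_of_nonpos hx1
      push_cast
      linarith
    have h3 : (k : ℝ) ^ (2 * k) ≤ δ / 2 * t := by
      rw [Real.rpow_neg hx0.le, ← div_eq_mul_inv, div_le_iff₀ (by positivity)] at hP2
      refine hP2.trans ?_
      gcongr
    calc (x / (2 * Z)) ^ (2 * k) * x ≤ (k * x ^ (-(e / 2)) * K) ^ (2 * k) * x := by gcongr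
      _ = (k : ℝ) ^ (2 * k) * K ^ (2 * k) * ((x ^ (-(e / 2))) ^ (2 * k) * x) := by
          rw [mul_pow, mul_pow]; ring
      _ ≤ (k : ℝ) ^ (2 * k) * K ^ (2 * k) * 1 := by gcongr
      _ ≤ δ / 2 * t * K ^ (2 * k) := by rw [mul_one]; gcongr
  classical
  set U : Finset (ZMod p) := (avoidingSet p G H).toFinset with hU
  have hUV : ∀ u ∈ U, ∀ v ∈ unityRoots (ZMod p) t, ∀ n ≤ k * (K - 1), v ≠ u + (n : ZMod p) := by
    intro u hu v hv n hn hvu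
    rw [hU, Set.mem_toFinset] at hu
    rw [ht, unityRoots_eq_image] at hv
    obtain ⟨g, hg, rfl⟩ := mem_image.1 hv
    refine hu ⟨g, (mem_filter.1 hg).2, n, lt_of_le_of_lt ?_ hKlt, hvu⟩
    exact_mod_cast hn
  have hmain := card_avoiding_le_short hZpos hUV
  rw [hcard, ← hS, ← hx] at hmain
  rw [Set.ncard_eq_toFinset_card']
  refine le_of_mul_le_mul_right ?_ (show (0 : ℝ) < t ^ 2 * K ^ (2 * k) by positivity)
  calc (#U : ℝ) * (t ^ 2 * K ^ (2 * k)) = #U * t ^ 2 * K ^ (2 * k) := by ring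
    _ ≤ x * (K ^ (2 * k) * (2 * S) + (x / (2 * Z)) ^ (2 * k) * (x * t)) := hmain
    _ = x * (K ^ (2 * k) * (2 * S) + (x / (2 * Z)) ^ (2 * k) * x * t) := by ring
    _ ≤ x * (K ^ (2 * k) * (2 * (δ / 4 * t ^ 2)) + δ / 2 * t * K ^ (2 * k) * t) := by gcongr
    _ = δ * x * (t ^ 2 * K ^ (2 * k)) := by ring
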